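/- Let $m\ge 1$ and $1\le s\le n-1$ be integers. In the triangular lattice with unit edges, one family of which is vertical, consider the hexagon with sides $n, n, 2m, n, n, 2m$ (in cyclic order, all angles $120^\circ$) whose two sides of length $2m$ are vertical. Its horizontal symmetry axis contains exactly $n+1$ lattice points of the hexagon; number them $1,\dots,n+1$ from left to right. Remove from the hexagon the two unit lattice triangles that are symmetric with respect to this axis and share the $(s+1)$-th of these vertices. A rhombus tiling of the remaining region is a partition of its unit lattice triangles into rhombi, each consisting of two unit triangles with a common edge. Then the number of rhombus tilings of the remaining region equals $$ \frac{(2m-1)\binom{2m-2}{m-1}\binom{2n-2s}{n-s}\binom{2s}{s}}{\binom{2m+2n}{m+n}}\, \prod_{i=1}^{n}\prod_{j=1}^{n}\prod_{k=1}^{2m}\frac{i+j+k-1}{i+j+k-2}. $$ -/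

import Mathlib

/-!
Points of the triangular lattice with unit edges, one family of edges being vertical, are written
as pairs `(x, y) : ℤ × ℤ`: the pair `(x, y)` stands for the point `x • (√3/2, 1/2) + y • (0, 1)`
of the plane.  Its height above the horizontal axis is `y + x/2`, and its six lattice neighbours
are `(x, y ± 1)`, `(x ± 1, y)`, `(x + 1, y - 1)` and `(x - 1, y + 1)`.
-/

/-- The unit triangles of the lattice.  Each has exactly one vertical edge, from `(x, y)` to
`(x, y + 1)`, and points either to the right or to the left of that edge. -/
inductive UnitTriangle : Type
  | pointingRight (x y : ℤ) : UnitTriangle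
  | pointingLeft (x y : ℤ) : UnitTriangle

namespace UnitTriangle

/-- The three corners of a unit triangle; the third listed is the one opposite to the vertical
edge. -/
def corners : UnitTriangle → Finset (ℤ × ℤ)
  | pointingRight x y => {(x, y), (x, y + 1), (x + 1, y)}
  | pointingLeft x y => {(x, y), (x, y + 1), (x - 1, y + 1)}

/-- Two unit triangles share an edge, that is, they have exactly two corners in common. -/
def ShareEdge (t u : UnitTriangle) : Prop := (t.corners ∩ u.corners).card = 2

end UnitTriangle

open UnitTriangle

/-- A unit rhombus: the union of two unit triangles that share an edge. -/
def IsRhombus (r : Set UnitTriangle) : Prop := ∃ t u, ShareEdge t u ∧ r = {t, u}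

/-- `T` is a rhombus tiling of the region `R` (a union of unit triangles): a set of rhombi
contained in `R` such that every unit triangle of `R` is covered by exactly one of them. -/
def IsRhombusTiling (R : Set UnitTriangle) (T : Set (Set UnitTriangle)) : Prop :=
  (∀ r ∈ T, IsRhombus r ∧ r ⊆ R) ∧ ∀ t ∈ R, ∃! r, r ∈ T ∧ t ∈ r

/-- The set of all rhombus tilings of a region. -/
def rhombusTilings (R : Set UnitTriangle) : Set (Set (Set UnitTriangle)) :=
  {T | IsRhombusTiling R T}

/-- The lattice points of the closed hexagon with sides `n, n, 2m, n, n, 2m`, whose sides of length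
`2m` are vertical and whose horizontal symmetry axis has height `0`.  Its corners are
`(0, m)`, `(n, m)`, `(2n, m - n)`, `(2n, -m - n)`, `(n, -m - n)`, `(0, -m)`, in clockwise order. -/
def hexagonPoints (n m : ℕ) : Set (ℤ × ℤ) :=
  {p | 0 ≤ p.1 ∧ p.1 ≤ 2 * n ∧ -(m + n : ℤ) ≤ p.2 ∧ p.2 ≤ m ∧
    -(m : ℤ) ≤ p.1 + p.2 ∧ p.1 + p.2 ≤ m + n}

/-- The unit triangles contained in the hexagon with sides `n, n, 2m, n, n, 2m`. -/
def hexagon (n m : ℕ) : Set UnitTriangle :=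
  {t | ∀ p ∈ t.corners, p ∈ hexagonPoints n m}

/-- The lattice points of the hexagon on the horizontal symmetry axis are
`(0, 0), (2, -1), (4, -2), …, (2n, -n)`, from left to right; this is the `(s + 1)`-th of them. -/
def axisVertex (s : ℕ) : ℤ × ℤ := (2 * s, -s)

/-- The unit triangle that has `p` as its rightmost corner and lies, symmetrically to the
horizontal line through `p`, to the left of `p`. -/
def triangleLeftOf (p : ℤ × ℤ) : UnitTriangle := pointingRight (p.1 - 1) p.2

/-- The unit triangle that has `p` as its leftmost corner and lies, symmetrically to the
horizontal line through `p`, to the right of `p`. -/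
def triangleRightOf (p : ℤ × ℤ) : UnitTriangle := pointingLeft (p.1 + 1) (p.2 - 1)

/-- The hexagon with sides `n, n, 2m, n, n, 2m` without the two unit triangles on the horizontal
symmetry axis that share the `(s + 1)`-th vertex on the axis. -/
def holeyHexagon (n m s : ℕ) : Set UnitTriangle :=
  hexagon n m \ {triangleLeftOf (axisVertex s), triangleRightOf (axisVertex s)}

/-- MacMahon's box product `B(a, b, c)`. -/
def boxProduct (a b c : ℕ) : ℚ :=
  ∏ i ∈ Finset.Icc 1 a, ∏ j ∈ Finset.Icc 1 b, ∏ k ∈ Finset.Icc 1 c,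
    ((i : ℚ) + j + k - 1) / ((i : ℚ) + j + k - 2)

/-- The lattice points on the axis inside the hexagon are the `axisVertex s` with `s ≤ n`. -/
theorem mem_hexagonPoints_axis_iff (n m : ℕ) (p : ℤ × ℤ) :
    (p ∈ hexagonPoints n m ∧ p.1 + 2 * p.2 = 0) ↔ ∃ s ≤ n, p = axisVertex s := by
  obtain ⟨x, y⟩ := p
  simp only [hexagonPoints, axisVertex, Set.mem_ofPred_eq, Prod.mk.injEq]
  constructor
  · rintro ⟨h, h0⟩
    exact ⟨(-y).toNat, by omega, by omega, by omega⟩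
  · rintro ⟨s, hs, rfl, rfl⟩
    omega

/-- For `1 ≤ s ≤ n - 1` both removed triangles are indeed in the hexagon. -/
theorem removed_subset_hexagon {n m s : ℕ} (hm : 1 ≤ m) (hs : 1 ≤ s) (hsn : s < n) :
    {triangleLeftOf (axisVertex s), triangleRightOf (axisVertex s)} ⊆ hexagon n m := by
  rintro t (rfl | rfl) <;>
    simp only [hexagon, hexagonPoints, triangleLeftOf, triangleRightOf, axisVertex, corners,
      Set.mem_ofPred_eq, Finset.mem_insert, Finset.mem_singleton] <;>
    rintro p (rfl | rfl | rfl) <;> dsimp only <;> omega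

/-- The hexagon consists of finitely many unit triangles. -/
theorem finite_hexagon (n m : ℕ) : (hexagon n m).Finite := by
  let S : Set (ℤ × ℤ) := Set.Icc 0 (2 * n : ℤ) ×ˢ Set.Icc (-(m + n : ℤ)) m
  have hS : S.Finite := (Set.finite_Icc _ _).prod (Set.finite_Icc _ _)
  refine ((hS.image fun p => pointingRight p.1 p.2).union
    (hS.image fun p => pointingLeft p.1 p.2)).subset ?_
  rintro (⟨x, y⟩ | ⟨x, y⟩) h
  · obtain ⟨h1, h2, h3, h4, -⟩ := h (x, y) (by simp [corners])
    exact Or.inl ⟨(x, y), ⟨⟨h1, h2⟩, ⟨h3, h4⟩⟩, rfl⟩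
  · obtain ⟨h1, h2, h3, h4, -⟩ := h (x, y) (by simp [corners])
    exact Or.inr ⟨(x, y), ⟨⟨h1, h2⟩, ⟨h3, h4⟩⟩, rfl⟩

/-- A finite region has finitely many rhombus tilings, so `Set.ncard` counts them. -/
theorem finite_rhombusTilings {R : Set UnitTriangle} (hR : R.Finite) :
    (rhombusTilings R).Finite :=
  hR.finite_subsets.finite_subsets.subset fun _ hT r hr => (hT.1 r hr).2

/-! A tiling is a perfect matching of triangles. Naming each triangle by its vertical edge turns it
into a bijection from the edges with a triangle of the region on their right to those with one on
their left, sending an edge to itself or to one of two neighbours one column to the right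
(`ncard_rhombusTilings_holeyHexagon`). The moved edges form lattice paths, which start on the left
side or at the right half of the hole and end on the right side or at the left half of the hole.

Conservation of the paths forces all these bijections to have equally many inversions
(`card_inversions_congr`), so the terms of the Leibniz formula share one sign, and the count is the
absolute value of the determinant of the adjacency matrix. That matrix is a submatrix of the
unitriangular `matchMatrix`, whose inverse consists of signed path numbers. By Jacobi's theorem on
complementary minors, the count is, up to sign, a determinant of order `2m + 1`: the matrix `M` of
path numbers between the vertical sides, bordered by a column `-a` and a row `-b` for the paths that
end or start in the hole, with corner `0`.

If `M w = a`, this determinant is `-(det M) (b · w)` (`det_bordered`). Here `det M` is MacMahon's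
product (`det_zchoose_eq_boxProduct`), so `b · w` must be the remaining quotient of binomials. The
vector `w` is sought as a combination of path numbers to virtual points on the axis, at odd
distances beyond the right side. The Chu–Vandermonde summation then reduces `M w = a` to a Hankel
system of central binomial coefficients, which partial fractions solve explicitly
(`sum_hankelSolution`). The pairing `b · w` becomes a balanced hypergeometric sum, evaluated by
Pfaff–Saalschütz (`sum_hankelSolution_mul`, `exists_path_system_solution`). -/

/-! ### Rising factorials and the Pfaff–Saalschütz summation -/

/-- The rising factorial `x (x + 1) ⋯ (x + k - 1)`. -/
def rising (x : ℚ) (k : ℕ) : ℚ := ∏ i ∈ Finset.range k, (x + i)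

theorem rising_zero (x : ℚ) : rising x 0 = 1 := by simp [rising]

theorem rising_succ (x : ℚ) (k : ℕ) : rising x (k + 1) = rising x k * (x + k) := by
  simp [rising, Finset.prod_range_succ]

theorem rising_succ' (x : ℚ) (k : ℕ) : rising x (k + 1) = x * rising (x + 1) k := by
  simp only [rising, Finset.prod_range_succ']
  rw [mul_comm]
  congr 1
  · simp
  · exact Finset.prod_congr rfl fun i _ => by push_cast; ring

theorem rising_shift (x : ℚ) (k : ℕ) : rising x k * (x + k) = x * rising (x + 1) k := by
  rw [← rising_succ, rising_succ']

theorem rising_add (x : ℚ) (k l : ℕ) : rising x (k + l) = rising x k * rising (x + k) l := by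
  simp only [rising, Finset.prod_range_add]
  congr 1
  exact Finset.prod_congr rfl fun i _ => by push_cast; ring

theorem rising_pos {x : ℚ} (hx : 0 < x) (k : ℕ) : 0 < rising x k :=
  Finset.prod_pos fun i _ => by positivity

theorem rising_ne_zero {x : ℚ} (hx : 0 < x) (k : ℕ) : rising x k ≠ 0 := (rising_pos hx k).ne'

/-- The partial sums of the telescoping that underlies the Pfaff–Saalschütz recurrence. -/
theorem saalschutz_partial_sum {a b c d : ℚ} (h : c + d = a + b + 1) (hc : 0 < c) (hd : 0 < d)
    (N K : ℕ) :
    ∑ k ∈ Finset.range (K + 1),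
      ((c + N) * (d + N) * ((-1) ^ k * ((N + 1).choose k : ℚ) * rising a k * rising (b + N + 1) k
          / (rising c k * rising d k))
        - (c - a + N) * (d - a + N) * ((-1) ^ k * (N.choose k : ℚ) * rising a k * rising (b + N) k
          / (rising c k * rising d k)))
      = (b + 1 + 2 * N) * ((-1) ^ K * (N.choose K : ℚ) * rising a (K + 1) * rising (b + N + 1) K
          / (rising c K * rising d K)) := by
  induction K with
  | zero =>
    obtain rfl : d = a + b + 1 - c := by linarith
    simp only [zero_add, Finset.sum_range_one, rising_zero, rising_succ, Nat.choose_zero_right]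
    push_cast
    ring
  | succ K ih =>
    rw [Finset.sum_range_succ, ih]
    have hc' := rising_ne_zero hc K
    have hd' := rising_ne_zero hd K
    have hcK : c + K ≠ 0 := by positivity
    have hdK : d + K ≠ 0 := by positivity
    have hK : ((N.choose (K + 1) : ℕ) : ℚ) * (K + 1) = N.choose K * (N - K) := by
      rcases le_or_gt K N with hKN | hKN
      · have := Nat.choose_succ_right_eq N K
        rw [← Nat.cast_sub hKN]
        exact_mod_cast this
      · simp [Nat.choose_eq_zero_of_lt hKN, Nat.choose_eq_zero_of_lt (hKN.trans K.lt_succ_self)]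
    -- Both binomials with lower index `K` and `K + 1` are polynomial multiples of the common factor
    -- `X`, so the goal becomes a rational identity.
    obtain ⟨X, hX⟩ : ∃ X : ℚ, (N.choose K : ℚ) = (K + 1) * X :=
      ⟨N.choose K / (K + 1), by field_simp⟩
    have hX' : ((N.choose (K + 1) : ℕ) : ℚ) = (N - K) * X := by
      have : (K + 1 : ℚ) ≠ 0 := by positivity
      apply mul_right_cancel₀ this
      rw [hK, hX]; ring
    have hB : rising (b + N) (K + 1) = (b + N) * rising (b + N + 1) K := rising_succ' _ _
    rw [hB, rising_succ a (K + 1), rising_succ (b + N + 1) K, rising_succ c K, rising_succ d K,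
      Nat.choose_succ_succ, Nat.cast_add, hX, hX']
    generalize rising a (K + 1) = A
    generalize rising (b + N + 1) K = P
    generalize rising c K = C at *
    generalize rising d K = D at *
    obtain rfl : b = c + d - a - 1 := by linarith
    field_simp
    push_cast
    ring

/-- The Pfaff–Saalschütz summation. -/
theorem saalschutz {a b c d : ℚ} (h : c + d = a + b + 1) (hc : 0 < c) (hd : 0 < d) (N : ℕ) :
    (∑ k ∈ Finset.range (N + 1), (-1) ^ k * (N.choose k : ℚ) * rising a k * rising (b + N) k
        / (rising c k * rising d k)) * (rising c N * rising d N)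
      = rising (c - a) N * rising (d - a) N := by
  induction N with
  | zero => simp [rising_zero]
  | succ N ih =>
    -- Summing up to `K = N + 1` exhausts both sums, and the closed form vanishes there because it
    -- contains the binomial of `N` over `N + 1`; what is left is a first-order recurrence in `N`.
    have key := saalschutz_partial_sum h hc hd N (N + 1)
    rw [Nat.choose_succ_self] at key
    simp only [Nat.cast_zero, mul_zero, zero_mul, zero_div, Finset.sum_sub_distrib,
      ← Finset.mul_sum] at key
    rw [Finset.sum_range_succ (fun k => (-1) ^ k * (N.choose k : ℚ) * rising a k * rising (b + N) k
        / (rising c k * rising d k)), Nat.choose_succ_self] at key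
    simp only [Nat.cast_zero, mul_zero, zero_mul, zero_div, add_zero] at key
    simp only [rising_succ, Nat.cast_succ, ← add_assoc]
    linear_combination (rising c N * rising d N) * key + (c - a + N) * (d - a + N) * ih

/-! ### Finite differences and partial fractions -/

theorem sum_choose_eq_fwdDiff (N : ℕ) (f : ℚ → ℚ) (z : ℚ) :
    ∑ k ∈ Finset.range (N + 1), (-1) ^ k * (N.choose k : ℚ) * f (z + k)
      = (-1) ^ N * (fwdDiff (1 : ℚ))^[N] f z := by
  rw [fwdDiff_iter_eq_sum_shift, Finset.mul_sum]
  refine Finset.sum_congr rfl fun k hk => ?_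
  have hk : k ≤ N := by simpa [Nat.lt_succ_iff] using hk
  obtain ⟨l, rfl⟩ := Nat.exists_eq_add_of_le hk
  have : ((-1 : ℚ) ^ l) * (-1) ^ l = 1 := by rw [← mul_pow]; simp
  simp only [add_tsub_cancel_left, nsmul_eq_mul, mul_one, zsmul_eq_mul]
  push_cast
  rw [pow_add]
  linear_combination (-(-1) ^ k * ((k + l).choose k : ℚ) * f (z + k)) * this

theorem sum_choose_eval_eq_zero {N : ℕ} {f : Polynomial ℚ} (hf : f.natDegree < N) (z : ℚ) :
    ∑ k ∈ Finset.range (N + 1), (-1) ^ k * (N.choose k : ℚ) * f.eval (z + k) = 0 := by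
  rw [sum_choose_eq_fwdDiff N (fun x => f.eval x) z]
  have := Polynomial.fwdDiff_iter_eq_zero_of_degree_lt hf
  rw [this]; simp

theorem fwdDiff_iter_inv (N : ℕ) : ∀ z : ℚ, 0 < z →
    (fwdDiff (1 : ℚ))^[N] (fun x => x⁻¹) z = (-1) ^ N * N.factorial / rising z (N + 1) := by
  induction N with
  | zero => intro z hz; simp [rising_succ, rising_zero]
  | succ N ih =>
    intro z hz
    have h1 : 0 < z + 1 := by positivity
    rw [Function.iterate_succ_apply', fwdDiff, ih z hz, ih _ h1, rising_succ' z (N + 1),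
      rising_succ' z N, rising_succ (z + 1) N, Nat.factorial_succ, pow_succ]
    have := rising_ne_zero h1 N
    have h2 : z + 1 + N ≠ 0 := by positivity
    field_simp
    push_cast
    ring

/-- Lagrange interpolation at equidistant nodes, as a partial fraction expansion. -/
theorem sum_choose_eval_div {N : ℕ} {f : Polynomial ℚ} (hf : f.natDegree ≤ N) (y z : ℚ)
    (hz : 0 < z) :
    ∑ k ∈ Finset.range (N + 1), (-1) ^ k * (N.choose k : ℚ) * (f.eval (y + z + k) / (z + k))
      = f.eval y * N.factorial / rising z (N + 1) := by
  -- Splitting off the value at `y` leaves a quotient `g` of degree below `N`, which the `N`-th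
  -- difference annihilates; only the multiple of the reciprocal function survives.
  obtain ⟨g, hg⟩ : Polynomial.X - Polynomial.C y ∣ f - Polynomial.C (f.eval y) :=
    Polynomial.X_sub_C_dvd_sub_C_eval
  have h1 : ∀ k : ℕ, f.eval (y + z + k) / (z + k)
      = g.eval (y + z + k) + f.eval y * (z + k)⁻¹ := by
    intro k
    have := congrArg (Polynomial.eval (y + z + k)) hg
    simp only [Polynomial.eval_sub, Polynomial.eval_mul, Polynomial.eval_C, Polynomial.eval_X] at this
    have hk : z + k ≠ 0 := by positivity
    field_simp
    linear_combination this
  have h2 : ∑ k ∈ Finset.range (N + 1), (-1) ^ k * (N.choose k : ℚ) * g.eval (y + z + k) = 0 := by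
    rcases eq_or_ne g 0 with rfl | hg0
    · simp
    · apply sum_choose_eval_eq_zero
      have h3 := congrArg Polynomial.natDegree hg
      rw [Polynomial.natDegree_mul (Polynomial.X_sub_C_ne_zero y) hg0, Polynomial.natDegree_X_sub_C,
        Polynomial.natDegree_sub_C] at h3
      omega
  have h3 := sum_choose_eq_fwdDiff N (fun x => x⁻¹) z
  rw [fwdDiff_iter_inv N z hz] at h3
  simp only [h1, mul_add, Finset.sum_add_distrib, h2, zero_add]
  have h4 : ((-1 : ℚ) ^ N) * (-1) ^ N = 1 := by rw [← mul_pow]; simp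
  calc _ = f.eval y * ∑ k ∈ Finset.range (N + 1), (-1) ^ k * (N.choose k : ℚ) * (z + k)⁻¹ := by
        rw [Finset.mul_sum]; exact Finset.sum_congr rfl fun k _ => by ring
    _ = _ := by
        rw [h3]
        linear_combination (f.eval y * N.factorial / rising z (N + 1)) * h4

/-! ### Central binomial coefficients and an explicit Hankel system -/

theorem cast_centralBinom_succ (k : ℕ) :
    ((k + 1).centralBinom : ℚ) * (k + 1) = k.centralBinom * (4 * (k + 1 / 2)) := by
  have := congrArg (Nat.cast (R := ℚ)) (Nat.succ_mul_centralBinom_succ k)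
  push_cast at this
  linear_combination this

theorem centralBinom_add (k j : ℕ) :
    ((k + j).centralBinom : ℚ) * rising (k + 1) j
      = k.centralBinom * 4 ^ j * rising (k + 1 / 2) j := by
  induction j with
  | zero => simp [rising_zero]
  | succ j ih =>
    have := cast_centralBinom_succ (k + j)
    rw [rising_succ, rising_succ, ← add_assoc]
    push_cast at this
    linear_combination (rising (k + 1) j) * this + 4 * (k + j + 1 / 2) * ih

theorem cast_centralBinom_ne_zero (k : ℕ) : (k.centralBinom : ℚ) ≠ 0 := by
  exact_mod_cast k.centralBinom_ne_zero

/-- The polynomial in `X` with value `rising (x + p) k` at `x`. -/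
noncomputable def risingPoly (p : ℚ) (k : ℕ) : Polynomial ℚ :=
  ∏ i ∈ Finset.range k, (Polynomial.X + Polynomial.C (p + i))

theorem eval_risingPoly (p x : ℚ) (k : ℕ) : (risingPoly p k).eval x = rising (x + p) k := by
  simp [risingPoly, rising, Polynomial.eval_prod, add_assoc]

theorem natDegree_risingPoly (p : ℚ) (k : ℕ) : (risingPoly p k).natDegree = k := by
  rw [risingPoly, Polynomial.natDegree_prod_of_monic _ _ fun i _ => Polynomial.monic_X_add_C _]
  simp only [Polynomial.natDegree_X_add_C]
  simp

/-- The solution of the Hankel system with matrix `centralBinom (s + t + 1 + i + j)`,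
`0 ≤ i, j ≤ N`, and right-hand side `centralBinom (s + j)`. -/
noncomputable def hankelSolution (s t N i : ℕ) : ℚ :=
  s.centralBinom * rising (t + 1) (N + 1) / (rising (s + 1) N * N.factorial) *
    ((-1) ^ i * (N.choose i : ℚ) / (t + 1 + i) * rising (s + t + 2 + i) N /
      (s + t + 1 + i).centralBinom)

/-- For every `j ≤ N`, the ratio of the central binomials of `y + j` and `y`, times `rising (y + 1)
N`, is a polynomial in `y` of degree `N`. The weights in `hankelSolution` do not depend on `j` and
are those of the partial fraction expansion with nodes `s + t + 1 + i`, so all equations hold by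
evaluating that polynomial at `y = s`. -/
theorem sum_hankelSolution (s t N j : ℕ) (hj : j ≤ N) :
    ∑ i ∈ Finset.range (N + 1), hankelSolution s t N i * ((s + t + 1 + i + j).centralBinom : ℚ)
      = (s + j).centralBinom := by
  obtain ⟨l, rfl⟩ := Nat.exists_eq_add_of_le hj
  have hpos : (0 : ℚ) < t + 1 := by positivity
  have ratio : ∀ y : ℕ, ((y + j).centralBinom : ℚ) * rising (y + 1) (j + l)
      = y.centralBinom * 4 ^ j * (rising (y + 1 / 2) j * rising (y + (j + 1)) l) := by
    intro y
    have := centralBinom_add y j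
    rw [rising_add, show (y : ℚ) + 1 + j = y + (j + 1) by ring]
    linear_combination rising (y + (j + 1)) l * this
  have hdeg : (risingPoly (1 / 2) j * risingPoly (j + 1) l).natDegree ≤ j + l :=
    (Polynomial.natDegree_mul_le).trans (by simp [natDegree_risingPoly])
  have main := sum_choose_eval_div hdeg s (t + 1) hpos
  simp only [Polynomial.eval_mul, eval_risingPoly] at main
  have hs := ratio s
  have n1 := rising_ne_zero (show (0 : ℚ) < s + 1 by positivity) (j + l)
  have n2 := rising_ne_zero hpos (j + l + 1)
  have n3 : ((j + l).factorial : ℚ) ≠ 0 := by exact_mod_cast (j + l).factorial_ne_zero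
  have n4 := cast_centralBinom_ne_zero s
  calc _ = s.centralBinom * rising (t + 1) (j + l + 1) / (rising (s + 1) (j + l) *
          (j + l).factorial) * 4 ^ j * ∑ i ∈ Finset.range (j + l + 1),
          (-1) ^ i * ((j + l).choose i : ℚ) * (rising (s + (t + 1) + i + 1 / 2) j *
            rising (s + (t + 1) + i + (j + 1)) l / (t + 1 + i)) := by
        rw [Finset.mul_sum]
        refine Finset.sum_congr rfl fun i _ => ?_
        have hr := ratio (s + t + 1 + i)
        have n5 := cast_centralBinom_ne_zero (s + t + 1 + i)
        push_cast at hr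
        rw [show (s : ℚ) + t + 1 + i + 1 = s + t + 2 + i by ring] at hr
        have hr' := eq_div_of_mul_eq n5 ((mul_comm _ _).trans ((mul_assoc _ _ _).symm.trans hr.symm))
        rw [show (s : ℚ) + (t + 1) + i = s + t + 1 + i by ring, hankelSolution]
        linear_combination (-(s.centralBinom * rising (t + 1) (j + l + 1) / (rising (s + 1) (j + l) *
          (j + l).factorial) * ((-1) ^ i * ((j + l).choose i : ℚ)) / (t + 1 + i))) * hr'
    _ = _ := by
        rw [main]
        generalize rising ((s : ℚ) + 1 / 2) j = A at *
        field_simp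
        linear_combination -hs

/-- Isolates the dependence on `i` in the form of a Saalschütz summand, with `a = t + 1/2`, `b = s +
t + 2`, `c = s + t + 3/2` and `d = t + 2`; these are balanced, as `c + d = a + b + 1`. -/
theorem hankelSolution_mul_centralBinom (s t N i : ℕ) :
    hankelSolution s t N i * ((t + i).centralBinom : ℚ)
      = s.centralBinom * rising (t + 1) (N + 1) / (rising (s + 1) N * N.factorial) *
        (rising (s + t + 2) N * t.centralBinom / ((t + 1) * (s + t + 1).centralBinom)) *
        ((-1) ^ i * (N.choose i : ℚ) * rising (t + 1 / 2) i *
          rising (s + t + 2 + N) i / (rising (s + t + 3 / 2) i * rising (t + 2) i)) := by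
  have f1 := centralBinom_add t i
  have f2 := centralBinom_add (s + t + 1) i
  push_cast at f2
  rw [show (s : ℚ) + t + 1 + 1 = s + t + 2 by ring,
    show (s : ℚ) + t + 1 + 1 / 2 = s + t + 3 / 2 by ring] at f2
  have f3 : rising ((t : ℚ) + 1) i * (t + 1 + i) = (t + 1) * rising (t + 2) i := by
    rw [rising_shift, show (t : ℚ) + 1 + 1 = t + 2 by ring]
  have f4 : rising ((s : ℚ) + t + 2) i * rising (s + t + 2 + i) N
      = rising (s + t + 2) N * rising (s + t + 2 + N) i := by
    rw [← rising_add, ← rising_add, add_comm i N]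
  have m2 := rising_ne_zero (show (0 : ℚ) < s + t + 3 / 2 by positivity) i
  have m3 := rising_ne_zero (show (0 : ℚ) < s + t + 2 by positivity) i
  have m4 := rising_ne_zero (show (0 : ℚ) < t + 1 by positivity) i
  have m5 := cast_centralBinom_ne_zero (s + t + 1)
  have m6 : (t + 1 + i : ℚ) ≠ 0 := by positivity
  have m7 : (t + 1 : ℚ) ≠ 0 := by positivity
  have g1 := eq_div_of_mul_eq m4 f1
  have g2 := eq_div_of_mul_eq m3 f2
  have g3 := eq_div_of_mul_eq m7 ((mul_comm _ _).trans f3.symm)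
  have g4 := eq_div_of_mul_eq m3 ((mul_comm _ _).trans f4)
  rw [hankelSolution, g1, g2, g3, g4]
  generalize rising ((s : ℚ) + t + 3 / 2) i = A at *
  generalize rising ((t : ℚ) + 1 / 2) i = B at *
  generalize rising ((s : ℚ) + t + 2) i = C at *
  generalize rising ((t : ℚ) + 1) i = D at *
  generalize rising ((s : ℚ) + t + 2 + N) i = E at *
  generalize rising ((s : ℚ) + t + 2) N = F at *
  generalize rising ((s : ℚ) + 1) N = G at *
  generalize rising ((t : ℚ) + 1) (N + 1) = H at *
  field_simp

theorem sum_hankelSolution_mul (s t N : ℕ) :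
    ∑ i ∈ Finset.range (N + 1), hankelSolution s t N i * ((t + i).centralBinom : ℚ)
      = (2 * N + 1) * N.centralBinom * s.centralBinom * t.centralBinom
        / (N + 1 + (s + t)).centralBinom := by
  have main := saalschutz (a := t + 1 / 2) (b := s + t + 2) (c := s + t + 3 / 2) (d := t + 2)
    (by ring) (by positivity) (by positivity) N
  rw [show (s : ℚ) + t + 3 / 2 - (t + 1 / 2) = s + 1 by ring,
    show (t : ℚ) + 2 - (t + 1 / 2) = 3 / 2 by ring] at main
  have n1 := rising_ne_zero (show (0 : ℚ) < s + 1 by positivity) N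
  have n3 : (N.factorial : ℚ) ≠ 0 := by exact_mod_cast N.factorial_ne_zero
  have n4 := cast_centralBinom_ne_zero (s + t + 1)
  have n5 := cast_centralBinom_ne_zero (N + 1 + (s + t))
  have n7 := rising_ne_zero (show (0 : ℚ) < t + 2 by positivity) N
  have n8 := rising_ne_zero (show (0 : ℚ) < s + t + 3 / 2 by positivity) N
  have n9 := rising_ne_zero (show (0 : ℚ) < s + t + 2 by positivity) N
  have e1 := centralBinom_add (s + t + 1) N
  rw [show s + t + 1 + N = N + 1 + (s + t) by ring] at e1
  push_cast at e1
  rw [show (s : ℚ) + t + 1 + 1 = s + t + 2 by ring,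
    show (s : ℚ) + t + 1 + 1 / 2 = s + t + 3 / 2 by ring] at e1
  -- The value `3/2` is `d - a`. With `N = m - 1`, this is the source of the factor `2m - 1` and of
  -- the binomial next to it in the final formula.
  have e2 : rising (3 / 2) N * 4 ^ N = (2 * N + 1) * N.centralBinom * N.factorial := by
    have h1 := centralBinom_add 0 N
    have h2 := rising_shift (1 / 2) N
    have h3 : ∀ k : ℕ, rising 1 k = k.factorial := by
      intro k
      induction k with
      | zero => simp [rising_zero]
      | succ k ih => rw [rising_succ, ih, Nat.factorial_succ]; push_cast; ring
    simp only [zero_add, Nat.cast_zero, Nat.centralBinom_zero, Nat.cast_one, h3] at h1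
    rw [show (1 / 2 + 1 : ℚ) = 3 / 2 by norm_num] at h2
    linear_combination (-2 * 4 ^ N) * h2 - 2 * (1 / 2 + N) * h1
  have e3 : rising ((t : ℚ) + 1) (N + 1) = (t + 1) * rising (t + 2) N := by
    rw [rising_succ', show (t : ℚ) + 1 + 1 = t + 2 by ring]
  simp only [hankelSolution_mul_centralBinom, ← Finset.mul_sum]
  rw [(eq_div_iff (mul_ne_zero n8 n7)).2 main, e3, eq_div_iff n5]
  generalize rising ((s : ℚ) + t + 3 / 2) N = A at *
  generalize rising ((s : ℚ) + t + 2) N = B at *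
  generalize rising ((t : ℚ) + 2) N = C at *
  generalize rising ((s : ℚ) + 1) N = D at *
  generalize rising (3 / 2) N = E at *
  have n10 : (t + 1 : ℚ) ≠ 0 := by positivity
  field_simp
  linear_combination (s.centralBinom * t.centralBinom : ℚ) *
    (E * e1 + ((s + t + 1).centralBinom * A : ℚ) * e2)

/-! ### Lattice path numbers and the linear system for the hole -/

/-- The binomial coefficient with an integer lower index. -/
def zchoose (a : ℕ) (k : ℤ) : ℚ := if 0 ≤ k then (a.choose k.toNat : ℚ) else 0

theorem zchoose_natCast (a k : ℕ) : zchoose a k = a.choose k := by simp [zchoose]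

theorem zchoose_of_neg (a : ℕ) {k : ℤ} (hk : k < 0) : zchoose a k = 0 := by
  simp [zchoose, not_le.2 hk]

theorem zchoose_of_lt {a : ℕ} {k : ℤ} (hk : a < k) : zchoose a k = 0 := by
  lift k to ℕ using by omega
  rw [zchoose_natCast, Nat.choose_eq_zero_of_lt (by omega), Nat.cast_zero]

theorem zchoose_zero (k : ℤ) : zchoose 0 k = if k = 0 then 1 else 0 := by
  rcases lt_trichotomy k 0 with h | rfl | h
  · rw [zchoose_of_neg _ h, if_neg h.ne]
  · simp [zchoose]
  · rw [zchoose_of_lt (by simpa using h), if_neg h.ne']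

theorem zchoose_succ (a : ℕ) (k : ℤ) :
    zchoose (a + 1) k = zchoose a k + zchoose a (k - 1) := by
  rcases lt_trichotomy k 0 with h | rfl | h
  · rw [zchoose_of_neg _ h, zchoose_of_neg _ h, zchoose_of_neg _ (by omega), add_zero]
  · simp [zchoose]
  · obtain ⟨l, rfl⟩ : ∃ l : ℕ, k = (l + 1 : ℕ) := ⟨(k - 1).toNat, by omega⟩
    rw [show ((l + 1 : ℕ) : ℤ) - 1 = (l : ℕ) by push_cast; ring]
    simp only [zchoose_natCast, Nat.choose_succ_succ]
    push_cast
    ring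

theorem zchoose_symm (a : ℕ) (k : ℤ) : zchoose a (a - k) = zchoose a k := by
  rcases lt_or_ge k 0 with h | h
  · rw [zchoose_of_neg _ h, zchoose_of_lt (by omega)]
  rcases lt_or_ge (a : ℤ) k with h' | h'
  · rw [zchoose_of_lt h', zchoose_of_neg _ (by omega)]
  lift k to ℕ using h
  have hk : k ≤ a := by omega
  rw [← Nat.cast_sub hk, zchoose_natCast, zchoose_natCast, Nat.choose_symm hk]

/-- The Chu–Vandermonde summation over any set that contains the support. -/
theorem sum_zchoose_mul_zchoose (a b : ℕ) : ∀ (S : Finset ℤ) (_ : Finset.Icc 0 (a : ℤ) ⊆ S) (c : ℤ),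
    ∑ k ∈ S, zchoose a k * zchoose b (c - k) = zchoose (a + b) c := by
  induction a with
  | zero =>
    intro S hS c
    have h0 : (0 : ℤ) ∈ S := hS (by simp)
    simp [zchoose_zero, h0]
  | succ a ih =>
    intro S hS c
    simp only [zchoose_succ a, add_mul, Finset.sum_add_distrib]
    have h1 := ih S (fun x hx => hS (by simp only [Finset.mem_Icc] at *; omega)) c
    have h2 := ih (S.map ⟨fun k => k - 1, sub_left_injective⟩) (fun x hx => by
      simp only [Finset.mem_map, Function.Embedding.coeFn_mk, Finset.mem_Icc] at *
      exact ⟨x + 1, hS (by simp only [Finset.mem_Icc]; omega), by omega⟩) (c - 1)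
    simp only [Finset.sum_map, Function.Embedding.coeFn_mk, sub_sub_sub_cancel_right] at h2
    rw [h1, h2, show a + 1 + b = a + b + 1 by omega, zchoose_succ]

theorem sum_fin_zchoose_mul_zchoose (a b p : ℕ) (d : ℤ) (hd : d ≤ 0) (hp : (a : ℤ) < d + p) (c : ℤ) :
    ∑ i : Fin p, zchoose a (d + i) * zchoose b (c - (d + i)) = zchoose (a + b) c := by
  have hinj : Function.Injective fun i : Fin p => d + (i : ℤ) := fun i j h => by
    have h : d + (i : ℤ) = d + (j : ℤ) := h
    exact Fin.ext (by omega)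
  have := sum_zchoose_mul_zchoose a b (Finset.univ.map ⟨_, hinj⟩) (fun x hx => by
      rw [Finset.mem_Icc] at hx
      rw [Finset.mem_map]
      exact ⟨⟨(x - d).toNat, by omega⟩, Finset.mem_univ _, by
        simp only [Function.Embedding.coeFn_mk]; omega⟩) c
  rwa [Finset.sum_map] at this

/-- The number of lattice paths with `2k + 1` steps `±1/2` that start at height `0` and end at
height `r + 1/2`. -/
def oddPaths (r : ℤ) (k : ℕ) : ℚ := zchoose (2 * k + 1) (k + 1 + r)

theorem oddPaths_symm (r : ℤ) (k : ℕ) : oddPaths (-1 - r) k = oddPaths r k := by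
  rw [oddPaths, oddPaths, ← zchoose_symm]
  congr 1
  push_cast
  ring

theorem oddPaths_zero (k : ℕ) : oddPaths 0 k = ((k + 1).centralBinom : ℚ) / 2 := by
  have h : (k + 1).centralBinom = (2 * k + 1).choose (k + 1) + (2 * k + 1).choose (k + 1) := by
    rw [Nat.centralBinom, show 2 * (k + 1) = 2 * k + 1 + 1 by ring, Nat.choose_succ_succ,
      show (2 * k + 1).choose k = (2 * k + 1).choose (k + 1) from
        Nat.choose_symm_of_eq_add (by omega)]
  rw [oddPaths, add_zero, show ((k : ℤ) + 1) = ((k + 1 : ℕ) : ℤ) by push_cast; rfl, zchoose_natCast, h]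
  push_cast
  ring

/-- Two further steps of `±1/2` change the height by `1`, `0` (in two ways) or `-1`. -/
theorem oddPaths_succ (r : ℤ) (k : ℕ) :
    oddPaths (r + 1) k = oddPaths r (k + 1) - 2 * oddPaths r k - oddPaths (r - 1) k := by
  simp only [oddPaths]
  rw [show 2 * (k + 1) + 1 = 2 * k + 1 + 1 + 1 by ring, zchoose_succ (2 * k + 1 + 1),
    zchoose_succ (2 * k + 1) (_ + 1 + r), zchoose_succ (2 * k + 1) (_ - 1)]
  rw [show ((k + 1 : ℕ) : ℤ) + 1 + r = k + 1 + (r + 1) by push_cast; ring,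
    show (k : ℤ) + 1 + (r + 1) - 1 = k + 1 + r by ring,
    show (k : ℤ) + 1 + r - 1 = k + 1 + (r - 1) by ring]
  ring

/-- The hypothesis is twice the case `r = 0`, by `oddPaths_zero`. The recurrence `oddPaths_succ`
trades one unit of height for one unit of length, so the equations for `i ≤ N` at height index `0`
give those at index `r` for `i + r ≤ N`. As it has order two in `r`, the induction carries two
consecutive heights. -/
theorem sum_mul_oddPaths {N n s : ℕ} {v : ℕ → ℚ}
    (hv : ∀ i ≤ N, ∑ j ∈ Finset.range (N + 1), v j * ((n + j + i + 1).centralBinom : ℚ)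
      = (s + i + 1).centralBinom) :
    ∀ r i : ℕ, i + r ≤ N →
      ∑ j ∈ Finset.range (N + 1), v j * oddPaths r (n + j + i) = oddPaths r (s + i) := by
  have h0 : ∀ i ≤ N,
      ∑ j ∈ Finset.range (N + 1), v j * oddPaths 0 (n + j + i) = oddPaths 0 (s + i) := by
    intro i hi
    simp only [oddPaths_zero, ← hv i hi, Finset.sum_div, mul_div_assoc]
  suffices H : ∀ r : ℕ, (∀ i, i + r ≤ N →
      ∑ j ∈ Finset.range (N + 1), v j * oddPaths r (n + j + i) = oddPaths r (s + i)) ∧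
      (∀ i, i + (r + 1) ≤ N → ∑ j ∈ Finset.range (N + 1), v j * oddPaths (r + 1) (n + j + i)
        = oddPaths (r + 1) (s + i)) from fun r => (H r).1
  intro r
  induction r with
  | zero =>
    refine ⟨fun i hi => by simpa using h0 i hi, fun i hi => ?_⟩
    -- Reflection in the axis identifies the height indices `-1` and `0`, so the recurrence closes
    -- up at its lower end.
    have h3 : ∀ k, oddPaths 1 k = oddPaths 0 (k + 1) - 3 * oddPaths 0 k := by
      intro k
      have := oddPaths_succ 0 k
      rw [show (0 : ℤ) - 1 = -1 - 0 by ring, oddPaths_symm, zero_add] at this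
      rw [this]; ring
    have e1 := h0 (i + 1) (by omega)
    have e2 := h0 i (by omega)
    simp only [Nat.cast_zero, zero_add, h3, mul_sub, Finset.sum_sub_distrib, mul_left_comm _ (3 : ℚ),
      ← Finset.mul_sum]
    simp only [← add_assoc] at e1
    rw [e1, e2]
  | succ r ih =>
    refine ⟨fun i hi => by simpa using ih.2 i hi, fun i hi => ?_⟩
    have e1 := ih.2 (i + 1) (by omega)
    have e2 := ih.2 i (by omega)
    have e3 := ih.1 i (by omega)
    simp only [Nat.cast_succ, oddPaths_succ (r + 1 : ℤ), mul_sub, Finset.sum_sub_distrib,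
      mul_left_comm _ (2 : ℚ), ← Finset.mul_sum, add_sub_cancel_right]
    simp only [← add_assoc] at e1
    rw [e1, e2, e3]

/-- The linear system whose matrix counts the paths between the two vertical sides and whose
right-hand side counts the paths that end in the hole, and the pairing of its solution with the
numbers of paths that start in the hole. -/
theorem exists_path_system_solution (s t N : ℕ) : ∃ w : Fin (2 * (N + 1)) → ℚ,
    (∀ i : Fin (2 * (N + 1)), ∑ j : Fin (2 * (N + 1)),
      zchoose (2 * (s + t + 2)) ((s + t + 2 : ℕ) + i - j) * w j
        = zchoose (2 * s + 1) (s + 1 + (i - (N + 1)))) ∧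
    ∑ j : Fin (2 * (N + 1)), zchoose (2 * t + 1) (t + (N + 1) - j) * w j
      = (2 * N + 1) * N.centralBinom * (s + 1).centralBinom * (t + 1).centralBinom
        / (N + 1 + (s + t + 2)).centralBinom := by
  set v := hankelSolution (s + 1) (t + 1) N with hv
  -- The `j`-th summand counts paths from the `i`-th edge of the right side to a virtual point of
  -- the axis, `2j + 1` columns further right. Multiplying by the matrix prolongs these paths back
  -- to the left side, so that `oddPaths` appears.
  refine ⟨fun i => ∑ j ∈ Finset.range (N + 1), v j * zchoose (2 * j + 1) ((j + 1 - (N + 1 : ℤ)) + i),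
    fun i => ?_, ?_⟩
  · have hsys : ∀ i ≤ N, ∑ j ∈ Finset.range (N + 1),
        v j * (((s + t + 2) + j + i + 1).centralBinom : ℚ) = (s + i + 1).centralBinom := by
      intro i hi
      have := sum_hankelSolution (s + 1) (t + 1) N i hi
      rw [show s + i + 1 = s + 1 + i by ring, ← this]
      refine Finset.sum_congr rfl fun j _ => ?_
      rw [show s + t + 2 + j + i + 1 = s + 1 + (t + 1) + 1 + j + i by ring]
    have hodd : ∀ r : ℕ, r ≤ N →
        ∑ j ∈ Finset.range (N + 1), v j * oddPaths r (s + t + 2 + j) = oddPaths r s :=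
      fun r hr => by simpa using sum_mul_oddPaths hsys r 0 (by omega)
    -- Rows mirrored in the axis give the same equation, so the `N + 1` unknowns `v j` suffice for
    -- `2 (N + 1)` rows.
    have hodd' : ∑ j ∈ Finset.range (N + 1), v j * oddPaths (i - (N + 1)) (s + t + 2 + j)
        = oddPaths (i - (N + 1)) s := by
      rcases le_or_gt (N + 1) (i : ℕ) with h | h
      · have := hodd (i - (N + 1)) (by omega)
        rwa [Nat.cast_sub h, Nat.cast_succ] at this
      · have := hodd (N - i) (by omega)
        rw [Nat.cast_sub (by omega)] at this
        rw [show (i : ℤ) - (N + 1) = -1 - (N - i) by ring]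
        simpa only [oddPaths_symm] using this
    rw [show zchoose (2 * s + 1) (s + 1 + (i - (N + 1))) = oddPaths (i - (N + 1)) s from rfl, ← hodd']
    simp only [Finset.mul_sum]
    rw [Finset.sum_comm]
    refine Finset.sum_congr rfl fun j hj => ?_
    have hj : j < N + 1 := by simpa using hj
    have := sum_fin_zchoose_mul_zchoose (2 * j + 1) (2 * (s + t + 2)) (2 * (N + 1)) (j + 1 - (N + 1))
      (by omega) (by push_cast; omega) ((s + t + 2 : ℕ) + i + (j + 1 - (N + 1)))
    rw [oddPaths, show 2 * (s + t + 2 + j) + 1 = 2 * j + 1 + 2 * (s + t + 2) by ring,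
      show ((s + t + 2 + j : ℕ) : ℤ) + 1 + (i - (N + 1))
        = (s + t + 2 : ℕ) + i + (j + 1 - (N + 1)) by push_cast; ring, ← this, Finset.mul_sum]
    refine Finset.sum_congr rfl fun k _ => ?_
    rw [show ((s + t + 2 : ℕ) : ℤ) + i + (j + 1 - (N + 1)) - (j + 1 - (N + 1) + k)
      = (s + t + 2 : ℕ) + i - k by ring]
    ring
  · have := sum_hankelSolution_mul (s + 1) (t + 1) N
    rw [show s + 1 + (t + 1) = s + t + 2 by ring] at this
    rw [← this]
    simp only [Finset.mul_sum]
    rw [Finset.sum_comm]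
    refine Finset.sum_congr rfl fun j hj => ?_
    have hj : j < N + 1 := by simpa using hj
    have := sum_fin_zchoose_mul_zchoose (2 * j + 1) (2 * t + 1) (2 * (N + 1)) (j + 1 - (N + 1))
      (by omega) (by push_cast; omega) ((t + 1 + j : ℕ) : ℤ)
    rw [zchoose_natCast, show 2 * j + 1 + (2 * t + 1) = 2 * (t + 1 + j) by ring,
      ← Nat.centralBinom] at this
    rw [← this, Finset.mul_sum]
    refine Finset.sum_congr rfl fun k _ => ?_
    rw [show ((t + 1 + j : ℕ) : ℤ) - (j + 1 - (N + 1) + k) = t + (N + 1) - k by push_cast; ring]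
    ring

/-! ### MacMahon's product as a determinant -/

theorem prod_Icc_div_telescope (q : ℚ) (hq : 0 < q) (n : ℕ) :
    ∏ j ∈ Finset.Icc 1 n, (q + j) / (q + j - 1) = (q + n) / q := by
  induction n with
  | zero => simp [hq.ne']
  | succ n ih =>
    rw [Finset.prod_Icc_succ_top (by omega), ih]
    have : q + n ≠ 0 := by positivity
    push_cast
    rw [show q + (n + 1) - 1 = q + n by ring]
    field_simp

theorem prod_Icc_add_div_add (n p k : ℕ) :
    ∏ i ∈ Finset.Icc 1 k, ((i : ℚ) + p + n) / (i + p)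
      = ((k + n + p).factorial : ℚ) * p.factorial / ((n + p).factorial * (k + p).factorial) := by
  induction k with
  | zero =>
    have h1 : ((n + p).factorial : ℚ) ≠ 0 := by exact_mod_cast (n + p).factorial_ne_zero
    have h2 : (p.factorial : ℚ) ≠ 0 := by exact_mod_cast p.factorial_ne_zero
    simp
    field_simp
  | succ k ih =>
    rw [Finset.prod_Icc_succ_top (by omega), ih, show k + 1 + n + p = k + n + p + 1 by ring,
      show k + 1 + p = k + p + 1 by ring, Nat.factorial_succ, Nat.factorial_succ]
    have h1 : ((n + p).factorial : ℚ) ≠ 0 := by exact_mod_cast (n + p).factorial_ne_zero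
    have h2 : ((k + p).factorial : ℚ) ≠ 0 := by exact_mod_cast (k + p).factorial_ne_zero
    have h3 : (k : ℚ) + 1 + p ≠ 0 := by positivity
    push_cast
    field_simp
    ring

/-- For fixed `k` the product over `j` telescopes, and the remaining product over `i` is a quotient
of factorials. -/
theorem boxProduct_eq_prod_factorial (n p : ℕ) : boxProduct n n p
    = ∏ k ∈ Finset.range p, ((2 * n + k).factorial : ℚ) * k.factorial / ((n + k).factorial) ^ 2 := by
  induction p with
  | zero => simp [boxProduct]
  | succ p ih =>
    rw [Finset.prod_range_succ, ← ih]
    simp only [boxProduct]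
    simp only [Finset.prod_Icc_succ_top (show 1 ≤ p + 1 by omega), Finset.prod_mul_distrib]
    congr 1
    have := prod_Icc_add_div_add n p n
    rw [show n + n + p = 2 * n + p by ring, ← pow_two] at this
    rw [← this]
    refine Finset.prod_congr rfl fun i hi => ?_
    have hi : 1 ≤ i := (Finset.mem_Icc.1 hi).1
    rw [← prod_Icc_div_telescope _ (by positivity) n]
    refine Finset.prod_congr rfl fun j _ => ?_
    push_cast
    congr 1 <;> ring

theorem det_vandermonde_fin_cast (p : ℕ) :
    (Matrix.vandermonde fun i : Fin p => (i : ℚ)).det = ∏ k ∈ Finset.range p, (k.factorial : ℚ) := by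
  cases p with
  | zero => simp
  | succ p =>
    rw [Matrix.det_vandermonde_id_eq_superFactorial, Finset.prod_range_succ',
      ← Nat.prod_range_factorial_succ]
    push_cast
    simp

theorem choose_eq_descPochhammer (n i j : ℕ) : ((j + 2 * n).choose (n + i) : ℚ)
    = ((2 * n + j).factorial / (n + j).factorial : ℚ) *
      (((n + i).factorial : ℚ)⁻¹ * (descPochhammer ℚ i).eval ((j : ℚ) + n)) := by
  have h1 : ((n + j).factorial : ℚ) ≠ 0 := by exact_mod_cast (n + j).factorial_ne_zero
  have h2 : ((n + i).factorial : ℚ) ≠ 0 := by exact_mod_cast (n + i).factorial_ne_zero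
  have h3 : (descPochhammer ℚ i).eval ((j : ℚ) + n) = ((n + j).descFactorial i : ℚ) := by
    rw [← descPochhammer_eval_eq_descFactorial]; push_cast; rw [add_comm]
  rw [h3]
  rcases le_or_gt i (n + j) with h | h
  · have e1 := Nat.factorial_mul_descFactorial h
    have e2 := Nat.choose_mul_factorial_mul_factorial (show n + i ≤ j + 2 * n by omega)
    rw [show j + 2 * n - (n + i) = n + j - i by omega, show j + 2 * n = 2 * n + j by ring] at e2
    have e1' : ((n + j - i).factorial : ℚ) * (n + j).descFactorial i = (n + j).factorial := by
      exact_mod_cast e1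
    have e2' : ((2 * n + j).choose (n + i) : ℚ) * (n + i).factorial * (n + j - i).factorial
        = (2 * n + j).factorial := by exact_mod_cast e2
    rw [show j + 2 * n = 2 * n + j by ring]
    field_simp
    rw [← e2', ← e1']
    ring
  · rw [Nat.choose_eq_zero_of_lt (by omega), Nat.descFactorial_eq_zero_iff_lt.2 h]
    simp

/-- MacMahon's box formula as a binomial determinant. -/
theorem det_zchoose_eq_boxProduct (n p : ℕ) :
    (Matrix.of fun i j : Fin p => zchoose (2 * n) (n + i - j)).det = boxProduct n n p := by
  -- Multiplying by this unitriangular Pascal matrix turns the entries into binomials of `2n + j`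
  -- over `n + i`, by Chu–Vandermonde. Up to row and column factors, these are monic polynomials of
  -- degree `i` evaluated at `j + n`, so a Vandermonde determinant remains.
  set U : Matrix (Fin p) (Fin p) ℚ := Matrix.of fun l j => zchoose j l with hU
  have hUdet : U.det = 1 := by
    rw [Matrix.det_of_isUpperTriangular]
    · exact Finset.prod_eq_one fun i _ => by simp [hU, zchoose_natCast]
    · intro i j hij
      have hij : (j : ℕ) < i := hij
      exact zchoose_of_lt (Nat.cast_lt.2 hij)
  rw [← mul_one (Matrix.det _), ← hUdet, ← Matrix.det_mul]
  have hmul : (Matrix.of fun i j : Fin p => zchoose (2 * n) (n + i - j)) * U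
      = Matrix.of fun i j : Fin p => ((2 * n + j).factorial / (n + j).factorial : ℚ) *
        (Matrix.of fun i j : Fin p => (((n + i).factorial : ℚ)⁻¹ *
          (Matrix.of fun i j : Fin p => (descPochhammer ℚ j).eval ((i : ℚ) + n)).transpose i j)) i j := by
    ext i j
    have := sum_fin_zchoose_mul_zchoose j (2 * n) p 0 le_rfl (by have := j.2; omega) ((n + i : ℕ) : ℤ)
    rw [zchoose_natCast, choose_eq_descPochhammer] at this
    simp only [Matrix.mul_apply, Matrix.of_apply, hU, Matrix.transpose_apply]
    rw [← this]
    refine Finset.sum_congr rfl fun l _ => ?_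
    rw [mul_comm]
    simp
  rw [hmul, Matrix.det_mul_row, Matrix.det_mul_column, Matrix.det_transpose,
    ← Matrix.det_eval_matrixOfPolynomials_eq_det_vandermonde (fun i : Fin p => (i : ℚ) + n)
      (fun j => descPochhammer ℚ j) (fun j => descPochhammer_natDegree ℚ j)
      (fun j => monic_descPochhammer ℚ j), Matrix.det_vandermonde_add, det_vandermonde_fin_cast,
    boxProduct_eq_prod_factorial,
    Fin.prod_univ_eq_prod_range (fun k => ((2 * n + k).factorial / (n + k).factorial : ℚ)),
    Fin.prod_univ_eq_prod_range (fun k => ((n + k).factorial : ℚ)⁻¹), ← Finset.prod_mul_distrib,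
    ← Finset.prod_mul_distrib]
  refine Finset.prod_congr rfl fun k _ => ?_
  rw [div_eq_mul_inv, div_eq_mul_inv, pow_two, mul_inv]
  ring

theorem boxProduct_pos (n p : ℕ) : 0 < boxProduct n n p := by
  rw [boxProduct_eq_prod_factorial]
  exact Finset.prod_pos fun k _ => by positivity

/-! ### Complementary minors and bordered determinants -/

section Minors

variable {V A B κ : Type*} [Fintype V] [Fintype A] [Fintype κ] [DecidableEq V] [DecidableEq A]
  [DecidableEq κ]

/-- Jacobi's theorem on complementary minors of a matrix of determinant `±1` and its inverse. -/
theorem abs_det_submatrix_eq_abs_det_compl (e₁ : A ⊕ κ ≃ V) (e₂ : B ⊕ κ ≃ V)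
    {Q P : Matrix V V ℚ} (hQP : Q * P = 1) (hQ : |Q.det| = 1) (φ : A ≃ B) :
    |(Q.submatrix (fun a => e₁ (Sum.inl a)) (fun a => e₂ (Sum.inl (φ a)))).det|
      = |(P.submatrix (fun k => e₂ (Sum.inr k)) (fun k => e₁ (Sum.inr k))).det| := by
  set e₃ : A ⊕ κ ≃ V := (Equiv.sumCongr φ (Equiv.refl κ)).trans e₂ with he₃
  set Q' := Q.submatrix e₁ e₃
  set P' := P.submatrix e₃ e₁
  have hQP' : Q' * P' = 1 := by
    rw [Matrix.submatrix_mul_equiv, hQP, Matrix.submatrix_one_equiv]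
  have hQ' : |Q'.det| = 1 := by rw [Matrix.abs_det_submatrix_equiv_equiv, hQ]
  rw [← Matrix.fromBlocks_toBlocks Q', ← Matrix.fromBlocks_toBlocks P', Matrix.fromBlocks_multiply,
    ← Matrix.fromBlocks_one, Matrix.fromBlocks_inj] at hQP'
  -- Replacing the first block column of the inverse by that of the identity makes both the factor
  -- and the product block triangular, with the two minors as their determinants.
  have hmul : Q' * Matrix.fromBlocks 1 P'.toBlocks₁₂ 0 P'.toBlocks₂₂
      = Matrix.fromBlocks Q'.toBlocks₁₁ 0 Q'.toBlocks₂₁ 1 := by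
    conv_lhs => rw [← Matrix.fromBlocks_toBlocks Q', Matrix.fromBlocks_multiply]
    rw [hQP'.2.1, hQP'.2.2.2]
    simp
  have hdet := congrArg (fun M => |Matrix.det M|) hmul
  simp only [Matrix.det_mul, Matrix.det_fromBlocks_zero₂₁, Matrix.det_fromBlocks_zero₁₂,
    Matrix.det_one, one_mul, mul_one, abs_mul, hQ'] at hdet
  exact hdet.symm

/-- Adding to the last column the combination of the other columns with coefficients `w` clears its
upper part. Only a solution `w` is needed, not the invertibility of `M`. -/
theorem det_bordered {M : Matrix A A ℚ} {a w : A → ℚ} (b : A → ℚ) (h : M.mulVec w = a) :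
    (Matrix.fromBlocks M (Matrix.of fun i (_ : Unit) => -a i) (Matrix.of fun (_ : Unit) j => -b j)
      0).det = -(M.det * ∑ j, b j * w j) := by
  have hmul : Matrix.fromBlocks M (Matrix.of fun i (_ : Unit) => -a i)
        (Matrix.of fun (_ : Unit) j => -b j) 0
        * Matrix.fromBlocks 1 (Matrix.of fun i (_ : Unit) => w i) 0 1
      = Matrix.fromBlocks M 0 (Matrix.of fun (_ : Unit) j => -b j)
        (Matrix.of fun _ _ => -∑ j, b j * w j) := by
    rw [Matrix.fromBlocks_multiply, Matrix.fromBlocks_inj]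
    refine ⟨by simp, ?_, by simp, ?_⟩
    · ext i j
      simp [← h, Matrix.mulVec, dotProduct, Matrix.mul_apply]
    · ext i j
      simp [Matrix.mul_apply]
  have hdet := congrArg Matrix.det hmul
  rw [Matrix.det_mul, Matrix.det_fromBlocks_zero₂₁, Matrix.det_fromBlocks_zero₁₂, Matrix.det_one,
    Matrix.det_one, mul_one, mul_one, Matrix.det_unique (n := Unit)] at hdet
  rw [hdet]
  simp

end Minors

/-! ### The matching matrix of the hexagon and its inverse -/

/-- The lower end points `(x, y)` of the vertical unit edges in the hexagon. -/
noncomputable def verticalEdges (n m : ℕ) : Finset (ℤ × ℤ) :=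
  (Finset.Icc 0 (2 * n : ℤ) ×ˢ Finset.Icc (-(m + n : ℤ)) (m - 1)).filter
    fun p => -(m : ℤ) ≤ p.1 + p.2 ∧ p.1 + p.2 + 1 ≤ m + n

theorem mem_verticalEdges {n m : ℕ} {p : ℤ × ℤ} : p ∈ verticalEdges n m ↔
    0 ≤ p.1 ∧ p.1 ≤ 2 * n ∧ -(m + n : ℤ) ≤ p.2 ∧ p.2 ≤ m - 1 ∧ -(m : ℤ) ≤ p.1 + p.2 ∧
      p.1 + p.2 + 1 ≤ m + n := by
  simp only [verticalEdges, Finset.mem_filter, Finset.mem_product, Finset.mem_Icc]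
  tauto

/-- One step to the right of a lattice path through vertical edges. -/
def PathStep (p q : ℤ × ℤ) : Prop := q.1 = p.1 + 1 ∧ (q.2 = p.2 ∨ q.2 = p.2 - 1)

instance (p q : ℤ × ℤ) : Decidable (PathStep p q) := by unfold PathStep; infer_instance

/-- The triangle to the right of the vertical edge at `p` shares an edge with the triangle to the
left of the vertical edge at `q`. -/
def Matched (p q : ℤ × ℤ) : Prop := q = p ∨ PathStep p q

instance (p q : ℤ × ℤ) : Decidable (Matched p q) := by unfold Matched; infer_instance

/-- The number of lattice paths from `p` to `q`, with sign. -/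
def pathWeight (p q : ℤ × ℤ) : ℚ :=
  if p.1 ≤ q.1 then (-1) ^ (q.1 - p.1).toNat * zchoose (q.1 - p.1).toNat (p.2 - q.2) else 0

/-- On the whole lattice, the signed path numbers are the Neumann series of the inverse of identity
plus step operator; for `p ≠ q` this is Pascal's rule. -/
theorem pathWeight_add (p q : ℤ × ℤ) :
    pathWeight p q + pathWeight (p.1 + 1, p.2) q + pathWeight (p.1 + 1, p.2 - 1) q
      = if p = q then 1 else 0 := by
  obtain ⟨x, y⟩ := p
  obtain ⟨x', y'⟩ := q
  simp only [pathWeight, Prod.mk.injEq]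
  rcases lt_trichotomy x x' with h | rfl | h
  · rw [if_pos h.le, if_pos (by omega), if_pos (by omega), if_neg (by omega)]
    obtain ⟨d, hd⟩ : ∃ d : ℕ, x' - x = d + 1 := ⟨(x' - x - 1).toNat, by omega⟩
    rw [show (x' - x).toNat = d + 1 by omega, show (x' - (x + 1)).toNat = d by omega, zchoose_succ,
      show y - y' - 1 = y - 1 - y' by ring]
    ring
  · rw [if_pos le_rfl, if_neg (by omega), if_neg (by omega)]
    simp [zchoose_zero, sub_eq_zero]
  · rw [if_neg (by omega), if_neg (by omega), if_neg (by omega), if_neg (by omega)]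
    simp

/-- Along a path `y` never increases and `x`, `x + y` never decrease, so a bound of the hexagon
violated by a step stays violated. Unrestricted path numbers therefore agree with those inside the
hexagon. -/
theorem pathWeight_eq_zero {n m : ℕ} {u v p : ℤ × ℤ} (hu : u ∈ verticalEdges n m)
    (hv : v ∈ verticalEdges n m) (hp : p ∉ verticalEdges n m) (h : PathStep u p) :
    pathWeight p v = 0 := by
  rw [mem_verticalEdges] at hu hv hp
  obtain ⟨h1, h2⟩ := h
  rw [pathWeight]
  split_ifs with hle
  · by_cases h3 : p.2 - v.2 < 0
    · rw [zchoose_of_neg _ h3, mul_zero]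
    by_cases h4 : v.1 - p.1 < p.2 - v.2
    · rw [zchoose_of_lt (by omega), mul_zero]
    exact absurd (by omega) hp
  · rfl

/-- The 0-1-matrix of `Matched` on the vertical edges of the hexagon. -/
noncomputable def matchMatrix (n m : ℕ) : Matrix (verticalEdges n m) (verticalEdges n m) ℚ :=
  Matrix.of fun u v => if Matched u v then 1 else 0

theorem matchMatrix_mul_pathWeight (n m : ℕ) :
    matchMatrix n m * (Matrix.of fun u v : verticalEdges n m => pathWeight u v) = 1 := by
  ext u v
  simp only [Matrix.mul_apply, matchMatrix, Matrix.of_apply, Matrix.one_apply]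
  rw [Finset.sum_coe_sort (verticalEdges n m)
    (fun w => (if Matched u w then 1 else 0) * pathWeight w v)]
  have hsplit : ∀ w : ℤ × ℤ, (if Matched u w then (1 : ℚ) else 0) * pathWeight w v
      = (if (u : ℤ × ℤ) = w then pathWeight w v else 0)
        + (if ((u : ℤ × ℤ).1 + 1, (u : ℤ × ℤ).2) = w then pathWeight w v else 0)
        + (if ((u : ℤ × ℤ).1 + 1, (u : ℤ × ℤ).2 - 1) = w then pathWeight w v else 0) := by
    rintro ⟨x, y⟩
    obtain ⟨⟨x', y'⟩, hu⟩ := u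
    simp only [Matched, PathStep, Prod.mk.injEq]
    split_ifs <;> first | omega | simp
  simp only [hsplit, Finset.sum_add_distrib, Finset.sum_ite_eq]
  have h1 : ∀ p, PathStep u p →
      (if p ∈ verticalEdges n m then pathWeight p v else 0) = pathWeight p v := by
    intro p hp
    split_ifs with h
    · rfl
    · exact (pathWeight_eq_zero u.2 v.2 h hp).symm
  rw [h1 (u.1.1 + 1, u.1.2) ⟨rfl, Or.inl rfl⟩, h1 (u.1.1 + 1, u.1.2 - 1) ⟨rfl, Or.inr rfl⟩, if_pos u.2, pathWeight_add]
  simp only [Subtype.ext_iff]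

/-- Ordered by columns of the hexagon, the matrix is block triangular with identity blocks on the
diagonal. -/
theorem det_matchMatrix (n m : ℕ) : (matchMatrix n m).det = 1 := by
  have hbt : (matchMatrix n m).BlockTriangular fun u => (u : ℤ × ℤ).1 := by
    intro u v huv
    simp only [matchMatrix, Matrix.of_apply]
    rw [if_neg]
    rintro (h | ⟨h, -⟩)
    · simp only [h] at huv; exact lt_irrefl _ huv
    · simp only [h] at huv; omega
  rw [hbt.det]
  refine Finset.prod_eq_one fun k _ => ?_
  have : (matchMatrix n m).toSquareBlock (fun u => (u : ℤ × ℤ).1) k = 1 := by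
    ext ⟨u, hu⟩ ⟨v, hv⟩
    simp only [Matrix.toSquareBlock_def, matchMatrix, Matrix.of_apply, Matched, PathStep,
      Matrix.one_apply, Subtype.ext_iff]
    refine if_congr ⟨?_, fun h => Or.inl h.symm⟩ rfl rfl
    rintro (h | h)
    · exact h.symm
    · omega
  rw [this, Matrix.det_one]

/-- The vertical edges that have a triangle of the region to their right. -/
noncomputable def rightEdges (n m s : ℕ) : Finset (ℤ × ℤ) :=
  (verticalEdges n m).filter fun p => p.1 ≠ 2 * n ∧ p ≠ (2 * (s : ℤ) - 1, -(s : ℤ))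

/-- The vertical edges that have a triangle of the region to their left. -/
noncomputable def leftEdges (n m s : ℕ) : Finset (ℤ × ℤ) :=
  (verticalEdges n m).filter fun p => p.1 ≠ 0 ∧ p ≠ (2 * (s : ℤ) + 1, -(s : ℤ) - 1)

theorem mem_rightEdges {n m s : ℕ} {p : ℤ × ℤ} : p ∈ rightEdges n m s ↔
    p ∈ verticalEdges n m ∧ p.1 ≠ 2 * n ∧ p ≠ (2 * (s : ℤ) - 1, -(s : ℤ)) := by simp [rightEdges]

theorem mem_leftEdges {n m s : ℕ} {p : ℤ × ℤ} : p ∈ leftEdges n m s ↔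
    p ∈ verticalEdges n m ∧ p.1 ≠ 0 ∧ p ≠ (2 * (s : ℤ) + 1, -(s : ℤ) - 1) := by simp [leftEdges]

/-- The edges missing from `rightEdges` are the end points of paths: the right side and the left
half of the hole. They index the columns of the complementary minor. -/
theorem exists_rightEdges_sum_equiv {n m s : ℕ} (hm : 1 ≤ m) (hs : 1 ≤ s) (hsn : s < n) :
    ∃ e : rightEdges n m s ⊕ (Fin (2 * m) ⊕ Unit) ≃ verticalEdges n m,
      (∀ r, (e (Sum.inl r) : ℤ × ℤ) = r) ∧
      (∀ j : Fin (2 * m), (e (Sum.inr (Sum.inl j)) : ℤ × ℤ) = (2 * (n : ℤ), (j : ℤ) - m - n)) ∧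
      (e (Sum.inr (Sum.inr ())) : ℤ × ℤ) = (2 * (s : ℤ) - 1, -(s : ℤ)) := by
  let f : rightEdges n m s ⊕ (Fin (2 * m) ⊕ Unit) → verticalEdges n m :=
    Sum.elim (fun r => ⟨r, (mem_rightEdges.1 r.2).1⟩) (Sum.elim
      (fun j => ⟨(2 * (n : ℤ), (j : ℤ) - m - n), by have := j.2; rw [mem_verticalEdges]; dsimp only; omega⟩)
      (fun _ => ⟨(2 * (s : ℤ) - 1, -(s : ℤ)), by rw [mem_verticalEdges]; dsimp only; omega⟩))
  have hf : Function.Bijective f := by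
    constructor
    · refine Function.Injective.sumElim (fun r r' h => Subtype.ext (Subtype.mk.inj h))
        (Function.Injective.sumElim (fun j j' h => ?_) (fun _ _ _ => rfl) fun j _ h => ?_) ?_
      · simp only [Subtype.mk.injEq, Prod.mk.injEq] at h
        exact Fin.ext (by omega)
      · simp only [Subtype.mk.injEq, Prod.mk.injEq] at h
        omega
      · rintro ⟨r, hr⟩ (j | _) h
        · exact (mem_rightEdges.1 hr).2.1 (congrArg (fun u => (Subtype.val u).1) h)
        · exact (mem_rightEdges.1 hr).2.2 (congrArg Subtype.val h)
    · rintro ⟨⟨x, y⟩, hv⟩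
      by_cases h1 : x = 2 * n
      · have hv' := mem_verticalEdges.1 hv
        dsimp only at hv'
        refine ⟨Sum.inr (Sum.inl ⟨(y + m + n).toNat, by omega⟩), ?_⟩
        simp only [f, Sum.elim_inl, Sum.elim_inr, Subtype.mk.injEq, Prod.mk.injEq]
        omega
      · by_cases h2 : (x, y) = (2 * (s : ℤ) - 1, -(s : ℤ))
        · exact ⟨Sum.inr (Sum.inr ()), Subtype.ext h2.symm⟩
        · exact ⟨Sum.inl ⟨(x, y), mem_rightEdges.2 ⟨hv, h1, h2⟩⟩, rfl⟩
  exact ⟨Equiv.ofBijective f hf, fun _ => rfl, fun _ => rfl, rfl⟩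

/-- The edges missing from `leftEdges` are the starting points of paths: the left side and the right
half of the hole. They index the rows of the complementary minor. -/
theorem exists_leftEdges_sum_equiv {n m s : ℕ} (hm : 1 ≤ m) (hs : 1 ≤ s) (hsn : s < n) :
    ∃ e : leftEdges n m s ⊕ (Fin (2 * m) ⊕ Unit) ≃ verticalEdges n m,
      (∀ r, (e (Sum.inl r) : ℤ × ℤ) = r) ∧
      (∀ j : Fin (2 * m), (e (Sum.inr (Sum.inl j)) : ℤ × ℤ) = (0, (j : ℤ) - m)) ∧
      (e (Sum.inr (Sum.inr ())) : ℤ × ℤ) = (2 * (s : ℤ) + 1, -(s : ℤ) - 1) := by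
  let f : leftEdges n m s ⊕ (Fin (2 * m) ⊕ Unit) → verticalEdges n m :=
    Sum.elim (fun r => ⟨r, (mem_leftEdges.1 r.2).1⟩) (Sum.elim
      (fun j => ⟨(0, (j : ℤ) - m), by have := j.2; rw [mem_verticalEdges]; dsimp only; omega⟩)
      (fun _ => ⟨(2 * (s : ℤ) + 1, -(s : ℤ) - 1), by rw [mem_verticalEdges]; dsimp only; omega⟩))
  have hf : Function.Bijective f := by
    constructor
    · refine Function.Injective.sumElim (fun r r' h => Subtype.ext (Subtype.mk.inj h))
        (Function.Injective.sumElim (fun j j' h => ?_) (fun _ _ _ => rfl) fun j _ h => ?_) ?_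
      · simp only [Subtype.mk.injEq, Prod.mk.injEq] at h
        exact Fin.ext (by omega)
      · simp only [Subtype.mk.injEq, Prod.mk.injEq] at h
        omega
      · rintro ⟨r, hr⟩ (j | _) h
        · exact (mem_leftEdges.1 hr).2.1 (congrArg (fun u => (Subtype.val u).1) h)
        · exact (mem_leftEdges.1 hr).2.2 (congrArg Subtype.val h)
    · rintro ⟨⟨x, y⟩, hv⟩
      by_cases h1 : x = 0
      · have hv' := mem_verticalEdges.1 hv
        dsimp only at hv'
        refine ⟨Sum.inr (Sum.inl ⟨(y + m).toNat, by omega⟩), ?_⟩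
        simp only [f, Sum.elim_inl, Sum.elim_inr, Subtype.mk.injEq, Prod.mk.injEq]
        omega
      · by_cases h2 : (x, y) = (2 * (s : ℤ) + 1, -(s : ℤ) - 1)
        · exact ⟨Sum.inr (Sum.inr ()), Subtype.ext h2.symm⟩
        · exact ⟨Sum.inl ⟨(x, y), mem_leftEdges.2 ⟨hv, h1, h2⟩⟩, rfl⟩
  exact ⟨Equiv.ofBijective f hf, fun _ => rfl, fun _ => rfl, rfl⟩

theorem card_rightEdges_eq_card_leftEdges {n m s : ℕ} (hm : 1 ≤ m) (hs : 1 ≤ s) (hsn : s < n) :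
    Fintype.card (rightEdges n m s) = Fintype.card (leftEdges n m s) := by
  obtain ⟨e₁, -⟩ := exists_rightEdges_sum_equiv hm hs hsn
  obtain ⟨e₂, -⟩ := exists_leftEdges_sum_equiv hm hs hsn
  have := Fintype.card_congr (e₁.trans e₂.symm)
  simpa only [Fintype.card_sum, Nat.add_right_cancel_iff] using this

theorem abs_neg_mul_path_factor (s t N : ℕ) :
    |-(boxProduct (s + t + 2) (s + t + 2) (2 * (N + 1)) *
      ((2 * N + 1) * N.centralBinom * (s + 1).centralBinom * (t + 1).centralBinom
        / (N + 1 + (s + t + 2)).centralBinom))|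
      = (2 * N + 1) * N.centralBinom * (s + 1).centralBinom * (t + 1).centralBinom
        / (N + 1 + (s + t + 2)).centralBinom * boxProduct (s + t + 2) (s + t + 2) (2 * (N + 1)) := by
  have h := boxProduct_pos (s + t + 2) (2 * (N + 1))
  generalize boxProduct (s + t + 2) (s + t + 2) (2 * (N + 1)) = b at *
  generalize Nat.centralBinom (N + 1 + (s + t + 2)) = c
  generalize Nat.centralBinom (s + 1) = d
  generalize Nat.centralBinom (t + 1) = e
  rw [abs_neg, abs_of_nonneg (by positivity), mul_comm]

/-- The determinant of the bipartite adjacency matrix of the unit triangles of the region. -/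
theorem abs_det_adjacency (s t N : ℕ)
    (φ : rightEdges (s + t + 2) (N + 1) (s + 1) ≃ leftEdges (s + t + 2) (N + 1) (s + 1)) :
    |(Matrix.of fun r r' : rightEdges (s + t + 2) (N + 1) (s + 1) =>
        if Matched r (φ r') then (1 : ℚ) else 0).det|
      = (2 * N + 1) * N.centralBinom * (s + 1).centralBinom * (t + 1).centralBinom
        / (N + 1 + (s + t + 2)).centralBinom * boxProduct (s + t + 2) (s + t + 2) (2 * (N + 1)) := by
  obtain ⟨e₁, h1, h2, h3⟩ := exists_rightEdges_sum_equiv (n := s + t + 2) (m := N + 1) (s := s + 1)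
    (by omega) (by omega) (by omega)
  obtain ⟨e₂, g1, g2, g3⟩ := exists_leftEdges_sum_equiv (n := s + t + 2) (m := N + 1) (s := s + 1)
    (by omega) (by omega) (by omega)
  have key := abs_det_submatrix_eq_abs_det_compl e₁ e₂ (matchMatrix_mul_pathWeight _ _)
    (by rw [det_matchMatrix, abs_one]) φ
  obtain ⟨w, hw, hbw⟩ := exists_path_system_solution s t N
  -- Paths between the sides have even length and those to or from the hole odd length, which
  -- explains the signs. The corner is `0` because the starting point in the hole lies to the right
  -- of the end point there.
  have hminor : (Matrix.of fun u v : verticalEdges (s + t + 2) (N + 1) => pathWeight u v).submatrix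
      (fun k => e₂ (Sum.inr k)) (fun k => e₁ (Sum.inr k))
      = Matrix.fromBlocks
        (Matrix.of fun i j : Fin (2 * (N + 1)) => zchoose (2 * (s + t + 2)) ((s + t + 2 : ℕ) + i - j))
        (Matrix.of fun i (_ : Unit) => -zchoose (2 * s + 1) (s + 1 + (i - (N + 1))))
        (Matrix.of fun (_ : Unit) j => -zchoose (2 * t + 1) (t + (N + 1) - j)) 0 := by
    ext (i | i) (j | j)
    · simp only [Matrix.submatrix_apply, Matrix.of_apply, Matrix.fromBlocks_apply₁₁, g2, h2,
        pathWeight]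
      rw [if_pos (by omega), show (2 * ((s + t + 2 : ℕ) : ℤ) - 0).toNat = 2 * (s + t + 2) by omega,
        Even.neg_one_pow (even_two_mul _), one_mul]
      congr 1
      ring
    · simp only [Matrix.submatrix_apply, Matrix.of_apply, Matrix.fromBlocks_apply₁₂, g2, h3,
        pathWeight]
      rw [if_pos (by omega), show (2 * ((s + 1 : ℕ) : ℤ) - 1 - 0).toNat = 2 * s + 1 by omega,
        Odd.neg_one_pow ⟨s, rfl⟩, neg_one_mul]
      congr 2
      push_cast
      ring
    · simp only [Matrix.submatrix_apply, Matrix.of_apply, Matrix.fromBlocks_apply₂₁, g3, h2,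
        pathWeight]
      rw [if_pos (by omega), show (2 * ((s + t + 2 : ℕ) : ℤ) - (2 * ((s + 1 : ℕ) : ℤ) + 1)).toNat
        = 2 * t + 1 by omega, Odd.neg_one_pow ⟨t, rfl⟩, neg_one_mul]
      congr 2
      push_cast
      ring
    · simp only [Matrix.submatrix_apply, Matrix.of_apply, Matrix.fromBlocks_apply₂₂, g3, h3,
        pathWeight]
      rw [if_neg (by omega)]
      rfl
  have hdet := det_bordered (fun j : Fin (2 * (N + 1)) => zchoose (2 * t + 1) (t + (N + 1) - j))
    (M := Matrix.of fun i j : Fin (2 * (N + 1)) =>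
      zchoose (2 * (s + t + 2)) ((s + t + 2 : ℕ) + i - j)) (w := w) (funext fun i => hw i)
  rw [hminor, hdet, det_zchoose_eq_boxProduct, hbw] at key
  refine Eq.trans ?_ (key.trans (abs_neg_mul_path_factor s t N))
  congr 2
  ext r r'
  simp [matchMatrix, h1, g1]

/-! ### Signs of bijections and the inversions of a matching -/

theorem sign_eq_neg_one_pow_card_inversions {α : Type*} [Fintype α] [LinearOrder α]
    (σ : Equiv.Perm α) : (Equiv.Perm.sign σ : ℤˣ)
      = (-1) ^ (Finset.univ.filter fun p : α × α => p.1 < p.2 ∧ σ p.2 < σ p.1).card := by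
  have e : Fin (Fintype.card α) ≃o α := Fintype.orderIsoFinOfCardEq α rfl
  rw [← Equiv.Perm.sign_permCongr e.symm.toEquiv σ, Equiv.Perm.sign_eq_prod_prod_Ioi,
    Finset.prod_sigma', Finset.prod_ite, Finset.prod_const_one, one_mul, Finset.prod_const]
  congr 1
  refine Finset.card_bij (fun p _ => (e p.1, e p.2)) ?_ ?_ ?_
  · rintro ⟨i, j⟩ hp
    simp only [Finset.mem_filter, Finset.mem_sigma, Finset.mem_univ, true_and, Finset.mem_Ioi,
      Equiv.permCongr_apply, not_lt] at hp ⊢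
    obtain ⟨hij, h⟩ := hp
    refine ⟨e.lt_iff_lt.2 hij, lt_of_le_of_ne ?_ fun h' => hij.ne' ?_⟩
    · exact e.symm.le_iff_le.1 h
    · exact e.injective (σ.injective h')
  · rintro ⟨i, j⟩ _ ⟨i', j'⟩ _ h
    simpa using h
  · rintro ⟨a, b⟩ hp
    simp only [Finset.mem_filter, Finset.mem_univ, true_and] at hp
    refine ⟨⟨e.symm a, e.symm b⟩, ?_, by simp⟩
    simp only [Finset.mem_filter, Finset.mem_sigma, Finset.mem_univ, true_and, Finset.mem_Ioi,
      Equiv.permCongr_apply, not_lt]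
    refine ⟨e.symm.lt_iff_lt.2 hp.1, e.symm.le_iff_le.2 ?_⟩
    simpa using hp.2.le

/-- Two finite types of the same cardinality, embedded into a linear order, have a reference
bijection with respect to which the sign of any other bijection is given by its inversions. -/
theorem exists_equiv_sign_eq {α β ι : Type*} [Fintype α] [Fintype β] [DecidableEq α] [LinearOrder ι]
    {f : α → ι} {g : β → ι} (hf : Function.Injective f) (hg : Function.Injective g)
    (hcard : Fintype.card α = Fintype.card β) :
    ∃ φ₀ : α ≃ β, ∀ φ : α ≃ β, (Equiv.Perm.sign (φ.trans φ₀.symm) : ℤˣ)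
      = (-1) ^ (Finset.univ.filter
        fun p : α × α => f p.1 < f p.2 ∧ g (φ p.2) < g (φ p.1)).card := by
  let _ : LinearOrder α := LinearOrder.lift' f hf
  let _ : LinearOrder β := LinearOrder.lift' g hg
  -- The reference bijection is the order isomorphism, so composing with its inverse preserves
  -- inversions.
  let φ₀ : α ≃o β := (Fintype.orderIsoFinOfCardEq α hcard).symm.trans
    (Fintype.orderIsoFinOfCardEq β rfl)
  refine ⟨φ₀.toEquiv, fun φ => ?_⟩
  have := sign_eq_neg_one_pow_card_inversions (φ.trans φ₀.toEquiv.symm)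
  convert this using 4 with p
  refine and_congr Iff.rfl ?_
  exact (φ₀.symm.lt_iff_lt (x := φ p.2) (y := φ p.1)).symm

/-- The lexicographic order on lattice points. -/
def LexLT (p q : ℤ × ℤ) : Prop := p.1 < q.1 ∨ p.1 = q.1 ∧ p.2 < q.2

instance (p q : ℤ × ℤ) : Decidable (LexLT p q) := by unfold LexLT; infer_instance

/-- The inversions of a map on a finite set of lattice points. -/
def inversions (R : Finset (ℤ × ℤ)) (f : ℤ × ℤ → ℤ × ℤ) : Finset ((ℤ × ℤ) × (ℤ × ℤ)) :=
  (R ×ˢ R).filter fun p => LexLT p.1 p.2 ∧ LexLT (f p.2) (f p.1)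

/-- The points of `R` fixed by `f`. -/
def fixedIn (R : Finset (ℤ × ℤ)) (f : ℤ × ℤ → ℤ × ℤ) : Finset (ℤ × ℤ) := R.filter fun p => f p = p

/-- The points of `R` moved by `f`. -/
def movedIn (R : Finset (ℤ × ℤ)) (f : ℤ × ℤ → ℤ × ℤ) : Finset (ℤ × ℤ) := R.filter fun p => f p ≠ p

/-- The points of `F` in the same column as `p` and above it. -/
def columnAbove (F : Finset (ℤ × ℤ)) (p : ℤ × ℤ) : Finset (ℤ × ℤ) :=
  F.filter fun q => q.1 = p.1 ∧ p.2 < q.2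

/-- The points of `F` in the same column as `p` and below it. -/
def columnBelow (F : Finset (ℤ × ℤ)) (p : ℤ × ℤ) : Finset (ℤ × ℤ) :=
  F.filter fun q => q.1 = p.1 ∧ q.2 < p.2

section Matching

variable {R L : Finset (ℤ × ℤ)} {f : ℤ × ℤ → ℤ × ℤ}

theorem pathStep_of_mem_movedIn (hstep : ∀ p ∈ R, Matched p (f p)) {p : ℤ × ℤ}
    (hp : p ∈ movedIn R f) : PathStep p (f p) := by
  rw [movedIn, Finset.mem_filter] at hp
  exact (hstep p hp.1).resolve_left hp.2

/-- In an inversion the first point moves and the second is fixed: moved points never overtake each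
other, and a fixed first point cannot be overtaken. The fixed point then lies above `p` in its
column or below `f p` in the next column. -/
theorem card_inversions (hstep : ∀ p ∈ R, Matched p (f p)) :
    (inversions R f).card = ∑ p ∈ movedIn R f, (columnAbove (fixedIn R f) p).card
      + ∑ p ∈ movedIn R f, (columnBelow (fixedIn R f) (f p)).card := by
  rw [← Finset.sum_add_distrib]
  have h1 : ∀ p ∈ movedIn R f, (columnAbove (fixedIn R f) p).card
      + (columnBelow (fixedIn R f) (f p)).card
      = ((fixedIn R f).filter fun q => (q.1 = p.1 ∧ p.2 < q.2) ∨ (q.1 = (f p).1 ∧ q.2 < (f p).2)).card := by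
    intro p hp
    rw [Finset.filter_or, Finset.card_union_of_disjoint]
    · rfl
    · rw [Finset.disjoint_filter]
      have := (pathStep_of_mem_movedIn hstep hp).1
      intro q _ h
      omega
  rw [Finset.sum_congr rfl h1, ← Finset.card_sigma]
  refine Finset.card_bij' (fun p _ => ⟨p.1, p.2⟩) (fun p _ => (p.1, p.2)) ?_ ?_ (fun _ _ => rfl)
    (fun _ _ => rfl)
  · rintro ⟨p, q⟩ h
    simp only [inversions, Finset.mem_filter, Finset.mem_product] at h
    obtain ⟨⟨hp, hq⟩, h2, h3⟩ := h
    simp only [LexLT] at h2 h3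
    simp only [Finset.mem_sigma, Finset.mem_filter, fixedIn, movedIn]
    rcases hstep p hp with h4 | ⟨h4, h5⟩
    · exfalso
      rcases hstep q hq with h6 | ⟨h6, h7⟩
      · rw [h4, h6] at h3; omega
      · rw [h4] at h3; omega
    · rcases hstep q hq with h6 | ⟨h6, h7⟩
      · rw [h6] at h3
        refine ⟨⟨hp, fun h => ?_⟩, ⟨hq, h6⟩, by omega⟩
        rw [h] at h4; omega
      · exfalso; omega
  · rintro ⟨p, q⟩ h
    simp only [Finset.mem_sigma, Finset.mem_filter] at h
    obtain ⟨hp, hq, h⟩ := h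
    have := (pathStep_of_mem_movedIn hstep hp).1
    simp only [fixedIn, movedIn, Finset.mem_filter] at hp hq
    simp only [inversions, Finset.mem_filter, Finset.mem_product, hq.2]
    exact ⟨⟨hp.1, hq.1⟩, by unfold LexLT; omega, by unfold LexLT; omega⟩

/-- Paths neither begin nor end at a point of both `R` and `L`: such a point is moved exactly if a
moved point arrives at it. -/
theorem image_movedIn_filter_mem (hf : Set.BijOn f R L) :
    ((movedIn R f).image f).filter (· ∈ R) = (movedIn R f).filter (· ∈ L) := by
  ext q
  simp only [Finset.mem_filter, Finset.mem_image, movedIn]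
  constructor
  · rintro ⟨⟨p, ⟨hp, hfp⟩, rfl⟩, hq⟩
    exact ⟨⟨hq, fun h => hfp (hf.injOn hq hp h)⟩, hf.mapsTo hp⟩
  · rintro ⟨⟨hq, hfq⟩, hqL⟩
    obtain ⟨p, hp, rfl⟩ := hf.surjOn hqL
    exact ⟨⟨p, ⟨hp, fun h => hfq (by rw [h, h])⟩, rfl⟩, hq⟩

theorem image_movedIn_filter_not_mem (hf : Set.BijOn f R L) :
    ((movedIn R f).image f).filter (· ∉ R) = L.filter (· ∉ R) := by
  ext q
  simp only [Finset.mem_filter, Finset.mem_image, movedIn]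
  refine and_congr_left fun hq => ⟨?_, fun hqL => ?_⟩
  · rintro ⟨p, ⟨hp, -⟩, rfl⟩
    exact hf.mapsTo hp
  · obtain ⟨p, hp, rfl⟩ := hf.surjOn hqL
    exact ⟨p, ⟨hp, fun h => hq (by rw [h]; exact hp)⟩, rfl⟩

theorem movedIn_filter_not_mem (hf : Set.BijOn f R L) :
    (movedIn R f).filter (· ∉ L) = R.filter (· ∉ L) := by
  ext q
  simp only [Finset.mem_filter, movedIn]
  refine ⟨fun h => ⟨h.1.1, h.2⟩, fun h => ⟨⟨h.1, fun h' => h.2 ?_⟩, h.2⟩⟩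
  rw [← h']
  exact hf.mapsTo h.1

theorem card_columnAbove_add_card_columnBelow {F : Finset (ℤ × ℤ)} {p : ℤ × ℤ} (hp : p ∉ F) :
    (columnAbove F p).card + (columnBelow F p).card = (F.filter fun q => q.1 = p.1).card := by
  rw [columnAbove, columnBelow, ← Finset.card_union_of_disjoint, ← Finset.filter_or]
  · congr 1
    refine Finset.filter_congr fun q hq => ⟨fun h => by omega, fun h => ?_⟩
    have : q.2 ≠ p.2 := fun h' => hp (by rwa [← Prod.ext h h'])
    omega
  · rw [Finset.disjoint_filter]
    intro q _ h
    omega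

/-- The number of inversions in terms of the points in `R ∩ L` and of the boundary points. -/
theorem card_inversions_eq (hf : Set.BijOn f R L) (hstep : ∀ p ∈ R, Matched p (f p)) :
    (inversions R f).card
      = ∑ p ∈ (movedIn R f).filter (· ∈ L), ((fixedIn R f).filter fun q => q.1 = p.1).card
        + ∑ p ∈ R.filter (· ∉ L), (columnAbove (fixedIn R f) p).card
        + ∑ p ∈ L.filter (· ∉ R), (columnBelow (fixedIn R f) p).card := by
  have hinj : Set.InjOn f (movedIn R f) :=
    hf.injOn.mono fun p hp => (Finset.mem_filter.1 (Finset.mem_coe.1 hp)).1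
  rw [card_inversions hstep, ← Finset.sum_image (f := fun p => (columnBelow (fixedIn R f) p).card) hinj,
    ← Finset.sum_filter_add_sum_filter_not (movedIn R f) (· ∈ L),
    ← Finset.sum_filter_add_sum_filter_not ((movedIn R f).image f) (· ∈ R),
    image_movedIn_filter_mem hf, image_movedIn_filter_not_mem hf, movedIn_filter_not_mem hf]
  have : ∑ p ∈ (movedIn R f).filter (· ∈ L), ((fixedIn R f).filter fun q => q.1 = p.1).card
      = ∑ p ∈ (movedIn R f).filter (· ∈ L), (columnAbove (fixedIn R f) p).card
        + ∑ p ∈ (movedIn R f).filter (· ∈ L), (columnBelow (fixedIn R f) p).card := by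
    rw [← Finset.sum_add_distrib]
    refine Finset.sum_congr rfl fun p hp => (card_columnAbove_add_card_columnBelow ?_).symm
    simp only [movedIn, fixedIn, Finset.mem_filter] at *
    tauto
  rw [this]
  ring

theorem card_filter_fixedIn_add (hf : Set.BijOn f R L) (P : ℤ × ℤ → Prop) [DecidablePred P] :
    ((fixedIn R f).filter P).card + (((movedIn R f).filter (· ∈ L)).filter P).card
      = ((R.filter (· ∈ L)).filter P).card := by
  rw [← Finset.card_union_of_disjoint]
  · congr 1
    ext q
    simp only [Finset.mem_union, Finset.mem_filter, fixedIn, movedIn]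
    constructor
    · rintro (⟨⟨h1, h2⟩, h3⟩ | ⟨⟨⟨h1, -⟩, h2⟩, h3⟩)
      · exact ⟨⟨h1, by rw [← h2]; exact hf.mapsTo h1⟩, h3⟩
      · exact ⟨⟨h1, h2⟩, h3⟩
    · tauto
  · rw [Finset.disjoint_left]
    intro q h1 h2
    simp only [Finset.mem_filter, fixedIn, movedIn] at h1 h2
    exact h2.1.1.2 h1.1.2

/-- The points that move out of a set of positions are as many as those that arrive in the
corresponding set. -/
theorem card_filter_movedIn (hf : Set.BijOn f R L) (hstep : ∀ p ∈ R, Matched p (f p))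
    {P Q : ℤ × ℤ → Prop} [DecidablePred P] [DecidablePred Q]
    (hPQ : ∀ p ∈ R, PathStep p (f p) → f p ∈ L → (P p ↔ Q (f p))) :
    (((movedIn R f).filter (· ∈ L)).filter P).card + ((R.filter (· ∉ L)).filter P).card
      = (((movedIn R f).filter (· ∈ L)).filter Q).card + ((L.filter (· ∉ R)).filter Q).card := by
  have hinj : Set.InjOn f (movedIn R f) :=
    hf.injOn.mono fun p hp => (Finset.mem_filter.1 (Finset.mem_coe.1 hp)).1
  have h1 : ((movedIn R f).filter P).card = (((movedIn R f).image f).filter Q).card := by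
    rw [Finset.filter_image, Finset.card_image_of_injOn (hinj.mono (Finset.coe_subset.2 (Finset.filter_subset _ _)))]
    congr 1
    refine Finset.filter_congr fun p hp => hPQ p (Finset.mem_filter.1 hp).1
      (pathStep_of_mem_movedIn hstep hp) (hf.mapsTo (Finset.mem_filter.1 hp).1)
  rw [← image_movedIn_filter_mem hf] at *
  rw [← image_movedIn_filter_not_mem hf, ← movedIn_filter_not_mem hf, image_movedIn_filter_mem hf]
  rw [Finset.filter_comm, Finset.filter_comm (p := (· ∉ L)),
    Finset.card_filter_add_card_filter_not, h1,
    ← Finset.card_filter_add_card_filter_not (s := ((movedIn R f).image f).filter Q) (· ∈ R),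
    Finset.filter_comm (p := Q), Finset.filter_comm (p := Q), image_movedIn_filter_mem hf]

end Matching

/-! ### Invariance of the number of inversions -/

section Hexagon

variable {n m s : ℕ} {f g : ℤ × ℤ → ℤ × ℤ}

/-- Induction on the column: `card_filter_movedIn` gives the change from one column to the next in
terms of the boundary points alone, which do not depend on the matching. -/
theorem card_column_moved_eq (hf : Set.BijOn f (rightEdges n m s) (leftEdges n m s))
    (hfs : ∀ p ∈ rightEdges n m s, Matched p (f p))
    (hg : Set.BijOn g (rightEdges n m s) (leftEdges n m s))
    (hgs : ∀ p ∈ rightEdges n m s, Matched p (g p)) (x : ℤ) :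
    (((movedIn (rightEdges n m s) f).filter (· ∈ leftEdges n m s)).filter fun q => q.1 = x).card
      = (((movedIn (rightEdges n m s) g).filter (· ∈ leftEdges n m s)).filter
        fun q => q.1 = x).card := by
  have hneg : ∀ (x : ℤ) (h : ℤ × ℤ → ℤ × ℤ), x ≤ 0 →
      ((movedIn (rightEdges n m s) h).filter (· ∈ leftEdges n m s)).filter (fun q => q.1 = x) = ∅ := by
    intro x h hx
    ext q
    simp only [Finset.mem_filter, mem_leftEdges, mem_verticalEdges, Finset.notMem_empty, iff_false]
    rintro ⟨⟨-, ⟨h1, -⟩, h2, -⟩, rfl⟩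
    omega
  rcases le_or_gt x 0 with hx | hx
  · rw [hneg x f hx, hneg x g hx]
  lift x to ℕ using hx.le
  clear hx
  induction x with
  | zero => rw [Nat.cast_zero, hneg _ f le_rfl, hneg _ g le_rfl]
  | succ x ih =>
    have h1 := card_filter_movedIn hf hfs (P := fun q => q.1 = x) (Q := fun q => q.1 = (x + 1 : ℕ))
      (fun p _ hp _ => by have := hp.1; push_cast; omega)
    have h2 := card_filter_movedIn hg hgs (P := fun q => q.1 = x) (Q := fun q => q.1 = (x + 1 : ℕ))
      (fun p _ hp _ => by have := hp.1; push_cast; omega)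
    omega

/-- As many paths pass above the hole to its left as to its right. -/
theorem card_above_hole (hs : 1 ≤ s) (hsn : s < n)
    (hf : Set.BijOn f (rightEdges n m s) (leftEdges n m s))
    (hfs : ∀ p ∈ rightEdges n m s, Matched p (f p)) :
    (((movedIn (rightEdges n m s) f).filter (· ∈ leftEdges n m s)).filter
        fun q => q.1 = 2 * (s : ℤ) - 1 ∧ -(s : ℤ) < q.2).card
      = (((movedIn (rightEdges n m s) f).filter (· ∈ leftEdges n m s)).filter
        fun q => q.1 = 2 * (s : ℤ) + 1 ∧ -(s : ℤ) - 1 < q.2).card := by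
  have hR : ∀ P : ℤ × ℤ → Prop, [DecidablePred P] → (∀ q, P q → q.1 ≠ 0 ∧
      q ≠ (2 * (s : ℤ) + 1, -(s : ℤ) - 1)) →
      (((rightEdges n m s).filter (· ∉ leftEdges n m s)).filter P).card = 0 := by
    intro P _ hP
    rw [Finset.card_eq_zero, Finset.filter_eq_empty_iff]
    intro q hq hPq
    rw [Finset.mem_filter, mem_rightEdges, mem_leftEdges] at hq
    exact hq.2 ⟨hq.1.1, hP q hPq⟩
  have hL : ∀ P : ℤ × ℤ → Prop, [DecidablePred P] → (∀ q, P q → q.1 ≠ 2 * n ∧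
      q ≠ (2 * (s : ℤ) - 1, -(s : ℤ))) →
      (((leftEdges n m s).filter (· ∉ rightEdges n m s)).filter P).card = 0 := by
    intro P _ hP
    rw [Finset.card_eq_zero, Finset.filter_eq_empty_iff]
    intro q hq hPq
    rw [Finset.mem_filter, mem_rightEdges, mem_leftEdges] at hq
    exact hq.2 ⟨hq.1.1, hP q hPq⟩
  -- The passage is followed in two steps through column `2s`. The two removed triangles exclude
  -- exactly the departure and the arrival for which being above the hole would not be preserved.
  have h1 := card_filter_movedIn hf hfs
    (P := fun q => q.1 = 2 * (s : ℤ) - 1 ∧ -(s : ℤ) < q.2)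
    (Q := fun q => q.1 = 2 * (s : ℤ) ∧ -(s : ℤ) - 1 < q.2) (by
      rintro ⟨x, y⟩ hp ⟨h1, h2⟩ -
      have h3 := (mem_rightEdges.1 hp).2.2
      simp only [ne_eq, Prod.mk.injEq] at h1 h2 h3 ⊢
      omega)
  have h2 := card_filter_movedIn hf hfs
    (P := fun q => q.1 = 2 * (s : ℤ) ∧ -(s : ℤ) - 1 < q.2)
    (Q := fun q => q.1 = 2 * (s : ℤ) + 1 ∧ -(s : ℤ) - 1 < q.2) (by
      intro p _ h1 h3
      have h3 := (mem_leftEdges.1 h3).2.2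
      obtain ⟨h1, h2⟩ := h1
      rw [ne_eq, Prod.ext_iff] at h3
      dsimp only at h3 ⊢
      omega)
  rw [hR _ fun q hq => ⟨by omega, fun h => by rw [h] at hq; dsimp only at hq; omega⟩,
    hL _ fun q hq => ⟨by omega, fun h => by rw [h] at hq; dsimp only at hq; omega⟩] at h1 h2
  omega

/-- The columns `x = 0` and `x = 2n` contain no fixed points, so of all boundary points only the two
at the hole contribute. -/
theorem card_inversions_eq_sum (hs : 1 ≤ s) (hsn : s < n)
    (hf : Set.BijOn f (rightEdges n m s) (leftEdges n m s))
    (hfs : ∀ p ∈ rightEdges n m s, Matched p (f p)) (hm : 1 ≤ m) :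
    (inversions (rightEdges n m s) f).card
      = ∑ p ∈ (movedIn (rightEdges n m s) f).filter (· ∈ leftEdges n m s),
          ((fixedIn (rightEdges n m s) f).filter fun q => q.1 = p.1).card
        + (columnAbove (fixedIn (rightEdges n m s) f) (2 * (s : ℤ) + 1, -(s : ℤ) - 1)).card
        + (columnBelow (fixedIn (rightEdges n m s) f) (2 * (s : ℤ) - 1, -(s : ℤ))).card := by
  have hfix : ∀ q ∈ fixedIn (rightEdges n m s) f, q.1 ≠ 0 ∧ q.1 ≠ 2 * n := by
    intro q hq
    rw [fixedIn, Finset.mem_filter] at hq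
    have := hf.mapsTo hq.1
    rw [hq.2] at this
    exact ⟨(mem_leftEdges.1 this).2.1, (mem_rightEdges.1 hq.1).2.1⟩
  rw [card_inversions_eq hf hfs]
  congr 1
  · congr 1
    refine Finset.sum_eq_single_of_mem (2 * (s : ℤ) + 1, -(s : ℤ) - 1) ?_ fun p hp hne => ?_
    · simp only [Finset.mem_filter, mem_rightEdges, mem_leftEdges, mem_verticalEdges, ne_eq,
        Prod.mk.injEq, not_true, and_false, not_false_eq_true, and_true]
      omega
    · rw [Finset.mem_filter, mem_leftEdges, mem_rightEdges] at hp
      rw [Finset.card_eq_zero, columnAbove, Finset.filter_eq_empty_iff]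
      intro q hq h
      exact hp.2 ⟨hp.1.1, fun h0 => (hfix q hq).1 (h.1.trans h0), hne⟩
  · refine Finset.sum_eq_single_of_mem (2 * (s : ℤ) - 1, -(s : ℤ)) ?_ fun p hp hne => ?_
    · simp only [Finset.mem_filter, mem_rightEdges, mem_leftEdges, mem_verticalEdges, ne_eq,
        Prod.mk.injEq, not_true, and_false, not_false_eq_true, and_true]
      omega
    · rw [Finset.mem_filter, mem_leftEdges, mem_rightEdges] at hp
      rw [Finset.card_eq_zero, columnBelow, Finset.filter_eq_empty_iff]
      intro q hq h
      exact hp.2 ⟨hp.1.1, fun h0 => (hfix q hq).2 (h.1.trans h0), hne⟩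

/-- All perfect matchings of the unit triangles of the region have the same number of
inversions. -/
theorem card_inversions_congr (hm : 1 ≤ m) (hs : 1 ≤ s) (hsn : s < n)
    (hf : Set.BijOn f (rightEdges n m s) (leftEdges n m s))
    (hfs : ∀ p ∈ rightEdges n m s, Matched p (f p))
    (hg : Set.BijOn g (rightEdges n m s) (leftEdges n m s))
    (hgs : ∀ p ∈ rightEdges n m s, Matched p (g p)) :
    (inversions (rightEdges n m s) f).card = (inversions (rightEdges n m s) g).card := by
  have hcol := card_column_moved_eq hf hfs hg hgs
  have hfixcol : ∀ x : ℤ, ((fixedIn (rightEdges n m s) f).filter fun q => q.1 = x).card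
      = ((fixedIn (rightEdges n m s) g).filter fun q => q.1 = x).card := by
    intro x
    have h1 := card_filter_fixedIn_add hf fun q => q.1 = x
    have h2 := card_filter_fixedIn_add hg fun q => q.1 = x
    have h3 := hcol x
    omega
  have hsum : ∀ h : ℤ × ℤ → ℤ × ℤ,
      ∑ p ∈ (movedIn (rightEdges n m s) h).filter (· ∈ leftEdges n m s),
        ((fixedIn (rightEdges n m s) g).filter fun q => q.1 = p.1).card
      = ∑ x ∈ Finset.Icc 0 (2 * n : ℤ),
        (((movedIn (rightEdges n m s) h).filter (· ∈ leftEdges n m s)).filter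
          fun q => q.1 = x).card * ((fixedIn (rightEdges n m s) g).filter fun q => q.1 = x).card := by
    intro h
    rw [← Finset.sum_fiberwise_of_maps_to (g := Prod.fst) (t := Finset.Icc 0 (2 * n : ℤ))]
    · refine Finset.sum_congr rfl fun x _ => ?_
      rw [← smul_eq_mul, ← Finset.sum_const]
      refine Finset.sum_congr rfl fun p hp => ?_
      rw [(Finset.mem_filter.1 hp).2]
    · intro p hp
      rw [Finset.mem_filter, mem_leftEdges, mem_verticalEdges] at hp
      exact Finset.mem_Icc.2 ⟨hp.2.1.1, hp.2.1.2.1⟩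
  -- Fixed points at the hole are all points there minus the moved ones. By `card_above_hole` the
  -- moved ones above on the right can be counted on the left instead; with those below on the left
  -- they make up the whole column `2s - 1`.
  have hboundary : ∀ h : ℤ × ℤ → ℤ × ℤ,
      Set.BijOn h (rightEdges n m s) (leftEdges n m s) →
      (∀ p ∈ rightEdges n m s, Matched p (h p)) →
      (columnAbove (fixedIn (rightEdges n m s) h) (2 * (s : ℤ) + 1, -(s : ℤ) - 1)).card
        + (columnBelow (fixedIn (rightEdges n m s) h) (2 * (s : ℤ) - 1, -(s : ℤ))).card
        + (((movedIn (rightEdges n m s) h).filter (· ∈ leftEdges n m s)).filter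
          fun q => q.1 = 2 * (s : ℤ) - 1).card
      = (((rightEdges n m s).filter (· ∈ leftEdges n m s)).filter
          fun q => q.1 = 2 * (s : ℤ) + 1 ∧ -(s : ℤ) - 1 < q.2).card
        + (((rightEdges n m s).filter (· ∈ leftEdges n m s)).filter
          fun q => q.1 = 2 * (s : ℤ) - 1 ∧ q.2 < -(s : ℤ)).card := by
    intro h hh hhs
    have h1 := card_filter_fixedIn_add hh fun q => q.1 = 2 * (s : ℤ) + 1 ∧ -(s : ℤ) - 1 < q.2
    have h2 := card_filter_fixedIn_add hh fun q => q.1 = 2 * (s : ℤ) - 1 ∧ q.2 < -(s : ℤ)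
    have h3 := card_columnAbove_add_card_columnBelow (p := (2 * (s : ℤ) - 1, -(s : ℤ)))
      (F := (movedIn (rightEdges n m s) h).filter (· ∈ leftEdges n m s)) (fun hmem =>
        (mem_rightEdges.1 (Finset.mem_filter.1 (Finset.mem_filter.1 hmem).1).1).2.2 rfl)
    have h4 := card_above_hole hs hsn hh hhs
    simp only [columnAbove, columnBelow] at *
    omega
  have hf' := hboundary f hf hfs
  have hg' := hboundary g hg hgs
  have hcol' := hcol (2 * (s : ℤ) - 1)
  rw [card_inversions_eq_sum hs hsn hf hfs hm, card_inversions_eq_sum hs hsn hg hgs hm]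
  simp only [hfixcol]
  rw [hsum f, hsum g]
  simp only [hcol]
  omega

end Hexagon

/-! ### The number of perfect matchings as a determinant -/

section Count

variable {n m s : ℕ}

theorem lexLT_iff_toLex_lt (p q : ℤ × ℤ) : LexLT p q ↔ toLex p < toLex q :=
  Prod.Lex.toLex_lt_toLex.symm

/-- The map on lattice points that extends a bijection between finite sets of lattice points. -/
def extendMap {R L : Finset (ℤ × ℤ)} (φ : R ≃ L) (p : ℤ × ℤ) : ℤ × ℤ :=
  if h : p ∈ R then φ ⟨p, h⟩ else p

theorem extendMap_coe {R L : Finset (ℤ × ℤ)} (φ : R ≃ L) (r : R) : extendMap φ r = φ r := by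
  simp [extendMap]

theorem bijOn_extendMap {R L : Finset (ℤ × ℤ)} (φ : R ≃ L) : Set.BijOn (extendMap φ) R L := by
  refine ⟨fun p hp => ?_, fun p hp q hq h => ?_, fun q hq => ?_⟩
  · rw [extendMap_coe φ ⟨p, hp⟩]
    exact (φ ⟨p, hp⟩).2
  · rw [extendMap_coe φ ⟨p, hp⟩, extendMap_coe φ ⟨q, hq⟩] at h
    exact congrArg Subtype.val (φ.injective (Subtype.ext h))
  · refine ⟨φ.symm ⟨q, hq⟩, (φ.symm ⟨q, hq⟩).2, ?_⟩
    rw [extendMap_coe, Equiv.apply_symm_apply]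

theorem card_inversions_extendMap {R L : Finset (ℤ × ℤ)} (φ : R ≃ L) :
    (Finset.univ.filter fun p : R × R => toLex (p.1 : ℤ × ℤ) < toLex (p.2 : ℤ × ℤ) ∧
      toLex (φ p.2 : ℤ × ℤ) < toLex (φ p.1 : ℤ × ℤ)).card
      = (inversions R (extendMap φ)).card := by
  refine Finset.card_bij (fun p _ => ((p.1 : ℤ × ℤ), (p.2 : ℤ × ℤ))) ?_ ?_ ?_
  · rintro ⟨p, q⟩ h
    simp only [Finset.mem_filter, Finset.mem_univ, true_and, ← lexLT_iff_toLex_lt] at h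
    simp only [inversions, Finset.mem_filter, Finset.mem_product, extendMap_coe]
    exact ⟨⟨p.2, q.2⟩, h⟩
  · rintro ⟨p, q⟩ _ ⟨p', q'⟩ _ h
    simp only [Prod.mk.injEq] at h
    exact Prod.ext (Subtype.ext h.1) (Subtype.ext h.2)
  · rintro ⟨p, q⟩ h
    simp only [inversions, Finset.mem_filter, Finset.mem_product] at h
    refine ⟨(⟨p, h.1.1⟩, ⟨q, h.1.2⟩), ?_, rfl⟩
    rw [Finset.mem_filter]
    simp only [← lexLT_iff_toLex_lt, ← extendMap_coe]
    exact ⟨Finset.mem_univ _, h.2⟩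

/-- The perfect matchings between the two kinds of unit triangles of the region. -/
def perfectMatchings (R L : Finset (ℤ × ℤ)) : Finset (R ≃ L) :=
  Finset.univ.filter fun φ => ∀ r : R, Matched r (φ r)

/-- Each nonzero term of the Leibniz formula comes from one perfect matching, and equal numbers of
inversions give all of them the same sign. -/
theorem exists_card_perfectMatchings_eq_abs_det (hm : 1 ≤ m) (hs : 1 ≤ s) (hsn : s < n) :
    ∃ φ₀ : rightEdges n m s ≃ leftEdges n m s,
      ((perfectMatchings (rightEdges n m s) (leftEdges n m s)).card : ℚ)
        = |(Matrix.of fun r r' : rightEdges n m s =>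
            if Matched r (φ₀ r') then (1 : ℚ) else 0).det| := by
  obtain ⟨φ₀, hφ₀⟩ := exists_equiv_sign_eq
    (f := fun r : rightEdges n m s => toLex (r : ℤ × ℤ))
    (g := fun r : leftEdges n m s => toLex (r : ℤ × ℤ))
    (fun r r' h => Subtype.ext (toLex.injective h)) (fun r r' h => Subtype.ext (toLex.injective h))
    (card_rightEdges_eq_card_leftEdges hm hs hsn)
  have hstep : ∀ φ ∈ perfectMatchings (rightEdges n m s) (leftEdges n m s),
      ∀ p ∈ rightEdges n m s, Matched p (extendMap φ p) := by
    intro φ hφ p hp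
    rw [extendMap_coe φ ⟨p, hp⟩]
    exact (Finset.mem_filter.1 hφ).2 ⟨p, hp⟩
  obtain ⟨ε, hε, hsign⟩ : ∃ ε : ℤˣ, |((ε : ℤ) : ℚ)| = 1 ∧
      ∀ φ ∈ perfectMatchings (rightEdges n m s) (leftEdges n m s),
        Equiv.Perm.sign (φ.trans φ₀.symm) = ε := by
    have habs : ∀ ε : ℤˣ, |((ε : ℤ) : ℚ)| = 1 := by
      intro ε
      rcases Int.units_eq_one_or ε with rfl | rfl <;> simp
    rcases (perfectMatchings (rightEdges n m s) (leftEdges n m s)).eq_empty_or_nonempty with h | ⟨ψ, hψ⟩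
    · exact ⟨1, habs 1, by simp [h]⟩
    · refine ⟨_, habs (Equiv.Perm.sign (ψ.trans φ₀.symm)), fun φ hφ => ?_⟩
      rw [hφ₀, hφ₀, card_inversions_extendMap, card_inversions_extendMap,
        card_inversions_congr hm hs hsn (bijOn_extendMap φ) (hstep φ hφ) (bijOn_extendMap ψ)
          (hstep ψ hψ)]
  refine ⟨φ₀, ?_⟩
  rw [← Matrix.det_transpose, Matrix.det_apply']
  have hterm : ∀ τ : Equiv.Perm (rightEdges n m s),
      ((Equiv.Perm.sign τ : ℤ) : ℚ) * ∏ r, (Matrix.of fun r r' : rightEdges n m s =>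
        if Matched r (φ₀ r') then (1 : ℚ) else 0).transpose (τ r) r
      = ((ε : ℤ) : ℚ) * if τ.trans φ₀ ∈ perfectMatchings (rightEdges n m s) (leftEdges n m s)
        then 1 else 0 := by
    intro τ
    simp only [Matrix.transpose_apply, Matrix.of_apply]
    split_ifs with h
    · have hs := hsign _ h
      rw [Equiv.trans_assoc, Equiv.self_trans_symm, Equiv.trans_refl] at hs
      rw [hs]
      congr 1
      exact Finset.prod_eq_one fun r _ => if_pos ((Finset.mem_filter.1 h).2 r)
    · rw [perfectMatchings, Finset.mem_filter, not_and] at h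
      obtain ⟨r, hr⟩ := not_forall.1 (h (Finset.mem_univ _))
      rw [mul_zero, Finset.prod_eq_zero (Finset.mem_univ r) (if_neg hr), mul_zero]
  rw [Finset.sum_congr rfl fun τ _ => hterm τ, ← Finset.mul_sum, abs_mul, hε, one_mul,
    Finset.sum_boole, abs_of_nonneg (Nat.cast_nonneg _)]
  congr 1
  refine Finset.card_bij' (fun φ _ => φ.trans φ₀.symm) (fun τ _ => τ.trans φ₀) ?_ ?_ ?_ ?_
  · intro φ hφ
    rw [Finset.mem_filter, Equiv.trans_assoc, Equiv.symm_trans_self, Equiv.trans_refl]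
    exact ⟨Finset.mem_univ _, hφ⟩
  · intro τ hτ
    exact (Finset.mem_filter.1 hτ).2
  · intro φ _
    rw [Equiv.trans_assoc, Equiv.symm_trans_self, Equiv.trans_refl]
  · intro τ _
    rw [Equiv.trans_assoc, Equiv.self_trans_symm, Equiv.trans_refl]

end Count

/-! ### Tilings as perfect matchings -/

section Tilings

variable {n m s : ℕ}

theorem pointingRight_mem_holeyHexagon {n m s : ℕ} (p : ℤ × ℤ) :
    pointingRight p.1 p.2 ∈ holeyHexagon n m s ↔ p ∈ rightEdges n m s := by
  obtain ⟨x, y⟩ := p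
  simp only [holeyHexagon, hexagon, hexagonPoints, triangleLeftOf, triangleRightOf, axisVertex,
    corners, Set.mem_sdiff, Set.mem_ofPred_eq, Finset.mem_insert, Finset.mem_singleton,
    Set.mem_insert_iff, Set.mem_singleton_iff, pointingRight.injEq, reduceCtorEq, or_false,
    mem_rightEdges, mem_verticalEdges, forall_eq_or_imp, forall_eq, ne_eq, Prod.mk.injEq]
  omega

theorem pointingLeft_mem_holeyHexagon {n m s : ℕ} (p : ℤ × ℤ) :
    pointingLeft p.1 p.2 ∈ holeyHexagon n m s ↔ p ∈ leftEdges n m s := by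
  obtain ⟨x, y⟩ := p
  simp only [holeyHexagon, hexagon, hexagonPoints, triangleLeftOf, triangleRightOf, axisVertex,
    corners, Set.mem_sdiff, Set.mem_ofPred_eq, Finset.mem_insert, Finset.mem_singleton,
    Set.mem_insert_iff, Set.mem_singleton_iff, pointingLeft.injEq, reduceCtorEq, false_or,
    mem_leftEdges, mem_verticalEdges, forall_eq_or_imp, forall_eq, ne_eq, Prod.mk.injEq]
  omega

theorem exists_two_common_corners {t u : UnitTriangle} (h : ShareEdge t u) :
    ∃ a b, a ≠ b ∧ a ∈ t.corners ∧ b ∈ t.corners ∧ a ∈ u.corners ∧ b ∈ u.corners := by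
  obtain ⟨a, b, hab, h⟩ := Finset.card_eq_two.1 h
  have ha : a ∈ t.corners ∩ u.corners := by simp [h]
  have hb : b ∈ t.corners ∩ u.corners := by simp [h]
  rw [Finset.mem_inter] at ha hb
  exact ⟨a, b, hab, ha.1, hb.1, ha.2, hb.2⟩

theorem card_corners (t : UnitTriangle) : t.corners.card = 3 := by
  rcases t with ⟨x, y⟩ | ⟨x, y⟩ <;>
    refine Finset.card_eq_three.2 ⟨_, _, _, ?_, ?_, ?_, rfl⟩ <;>
    simp only [ne_eq, Prod.mk.injEq] <;> omega

theorem not_shareEdge_self (t : UnitTriangle) : ¬ ShareEdge t t := by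
  rw [ShareEdge, Finset.inter_self, card_corners]
  omega

theorem shareEdge_comm {t u : UnitTriangle} : ShareEdge t u ↔ ShareEdge u t := by
  rw [ShareEdge, ShareEdge, Finset.inter_comm]

theorem shareEdge_right_left (p q : ℤ × ℤ) :
    ShareEdge (pointingRight p.1 p.2) (pointingLeft q.1 q.2) ↔ Matched p q := by
  obtain ⟨x, y⟩ := p
  obtain ⟨x', y'⟩ := q
  simp only [Matched, PathStep, Prod.mk.injEq]
  constructor
  · intro h
    obtain ⟨⟨a, a'⟩, ⟨b, b'⟩, hab, h1, h2, h3, h4⟩ := exists_two_common_corners h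
    simp only [corners, Finset.mem_insert, Finset.mem_singleton, Prod.mk.injEq, ne_eq] at *
    omega
  · intro h
    have : ∃ a b, a ≠ b ∧ (pointingRight x y).corners ∩ (pointingLeft x' y').corners = {a, b} := by
      rcases h with ⟨rfl, rfl⟩ | ⟨rfl, rfl | rfl⟩
      · refine ⟨(x', y'), (x', y' + 1), by simp, ?_⟩
        ext ⟨a, b⟩
        simp only [corners, Finset.mem_inter, Finset.mem_insert, Finset.mem_singleton, Prod.mk.injEq]
        omega
      · refine ⟨(x + 1, y'), (x, y' + 1), by simp, ?_⟩
        ext ⟨a, b⟩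
        simp only [corners, Finset.mem_inter, Finset.mem_insert, Finset.mem_singleton, Prod.mk.injEq]
        omega
      · refine ⟨(x + 1, y), (x, y), by simp, ?_⟩
        ext ⟨a, b⟩
        simp only [corners, Finset.mem_inter, Finset.mem_insert, Finset.mem_singleton, Prod.mk.injEq]
        omega
    obtain ⟨a, b, hab, h⟩ := this
    rw [ShareEdge, h, Finset.card_pair hab]

/-- Distinct triangles of the same orientation have at most one corner in common, so a rhombus
contains one of each orientation. -/
theorem exists_of_isRhombus {r : Set UnitTriangle} (h : IsRhombus r) :
    ∃ p q : ℤ × ℤ, Matched p q ∧ r = {pointingRight p.1 p.2, pointingLeft q.1 q.2} := by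
  obtain ⟨t, u, h, rfl⟩ := h
  rcases t with ⟨x, y⟩ | ⟨x, y⟩ <;> rcases u with ⟨x', y'⟩ | ⟨x', y'⟩
  · exfalso
    obtain ⟨⟨a, a'⟩, ⟨b, b'⟩, hab, h1, h2, h3, h4⟩ := exists_two_common_corners h
    have : x = x' ∧ y = y' := by
      simp only [corners, Finset.mem_insert, Finset.mem_singleton, Prod.mk.injEq, ne_eq] at *
      omega
    obtain ⟨rfl, rfl⟩ := this
    exact not_shareEdge_self _ h
  · exact ⟨(x, y), (x', y'), (shareEdge_right_left _ _).1 h, rfl⟩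
  · exact ⟨(x', y'), (x, y), (shareEdge_right_left _ _).1 (shareEdge_comm.1 h), Set.pair_comm _ _⟩
  · exfalso
    obtain ⟨⟨a, a'⟩, ⟨b, b'⟩, hab, h1, h2, h3, h4⟩ := exists_two_common_corners h
    have : x = x' ∧ y = y' := by
      simp only [corners, Finset.mem_insert, Finset.mem_singleton, Prod.mk.injEq, ne_eq] at *
      omega
    obtain ⟨rfl, rfl⟩ := this
    exact not_shareEdge_self _ h

/-- The rhombus made of the triangle to the right of `p` and the triangle to the left of `q`. -/
def rhombusOf (p q : ℤ × ℤ) : Set UnitTriangle := {pointingRight p.1 p.2, pointingLeft q.1 q.2}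

theorem right_mem_rhombusOf {a p q : ℤ × ℤ} : pointingRight a.1 a.2 ∈ rhombusOf p q ↔ a = p := by
  simp [rhombusOf, Prod.ext_iff]

theorem left_mem_rhombusOf {a p q : ℤ × ℤ} : pointingLeft a.1 a.2 ∈ rhombusOf p q ↔ a = q := by
  simp [rhombusOf, Prod.ext_iff]

theorem rhombusOf_injective {p q p' q' : ℤ × ℤ} (h : rhombusOf p q = rhombusOf p' q') :
    p = p' ∧ q = q' :=
  ⟨right_mem_rhombusOf.1 (h ▸ right_mem_rhombusOf.2 rfl),
    left_mem_rhombusOf.1 (h ▸ left_mem_rhombusOf.2 rfl)⟩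

/-- The rhombi of a perfect matching. -/
def tilingOf (φ : rightEdges n m s ≃ leftEdges n m s) : Set (Set UnitTriangle) :=
  Set.range fun p : rightEdges n m s => rhombusOf p (φ p)

theorem isRhombusTiling_tilingOf {φ : rightEdges n m s ≃ leftEdges n m s}
    (hφ : ∀ r : rightEdges n m s, Matched r (φ r)) : IsRhombusTiling (holeyHexagon n m s) (tilingOf φ) := by
  constructor
  · rintro _ ⟨p, rfl⟩
    refine ⟨⟨_, _, (shareEdge_right_left _ _).2 (hφ p), rfl⟩, ?_⟩
    rintro t (rfl | rfl)
    · exact (pointingRight_mem_holeyHexagon _).2 p.2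
    · exact (pointingLeft_mem_holeyHexagon _).2 (φ p).2
  · rintro (⟨x, y⟩ | ⟨x, y⟩) ht
    · have hp := (pointingRight_mem_holeyHexagon (x, y)).1 ht
      refine ⟨_, ⟨⟨⟨(x, y), hp⟩, rfl⟩, right_mem_rhombusOf (a := (x, y)).2 rfl⟩, ?_⟩
      rintro _ ⟨⟨p, rfl⟩, h⟩
      have h := right_mem_rhombusOf (a := (x, y)).1 h
      rw [show p = ⟨(x, y), hp⟩ from Subtype.ext h.symm]
    · have hq := (pointingLeft_mem_holeyHexagon (x, y)).1 ht
      refine ⟨_, ⟨⟨φ.symm ⟨(x, y), hq⟩, rfl⟩, left_mem_rhombusOf (a := (x, y)).2 (by simp)⟩, ?_⟩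
      rintro _ ⟨⟨p, rfl⟩, h⟩
      have h := left_mem_rhombusOf (a := (x, y)).1 h
      rw [show p = φ.symm ⟨(x, y), hq⟩ from (φ.eq_symm_apply).2 (Subtype.ext h.symm)]

theorem tilingOf_injective :
    Function.Injective (tilingOf : (rightEdges n m s ≃ leftEdges n m s) → _) := by
  intro φ ψ h
  refine Equiv.ext fun p => ?_
  have hp : rhombusOf p (φ p) ∈ tilingOf ψ := h ▸ ⟨p, rfl⟩
  obtain ⟨p', hp'⟩ := hp
  obtain ⟨h1, h2⟩ := rhombusOf_injective hp'
  rw [Subtype.ext h1] at h2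
  exact Subtype.ext h2.symm

/-- Covering the right-pointing triangles exactly once defines the map; for the left-pointing ones,
uniqueness of the cover gives injectivity and existence gives surjectivity. -/
theorem exists_tilingOf_eq {T : Set (Set UnitTriangle)}
    (hT : IsRhombusTiling (holeyHexagon n m s) T) :
    ∃ φ : rightEdges n m s ≃ leftEdges n m s, (∀ r : rightEdges n m s, Matched r (φ r)) ∧ tilingOf φ = T := by
  have hrhombus : ∀ r ∈ T, ∃ (p : rightEdges n m s) (q : leftEdges n m s),
      Matched p q ∧ r = rhombusOf p q := by
    intro r hr
    obtain ⟨hr1, hr2⟩ := hT.1 r hr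
    obtain ⟨p, q, hpq, rfl⟩ := exists_of_isRhombus hr1
    exact ⟨⟨p, (pointingRight_mem_holeyHexagon p).1 (hr2 (Or.inl rfl))⟩,
      ⟨q, (pointingLeft_mem_holeyHexagon q).1 (hr2 (Or.inr rfl))⟩, hpq, rfl⟩
  have hright : ∀ p : rightEdges n m s, ∃ q : leftEdges n m s,
      Matched p q ∧ rhombusOf p q ∈ T := by
    intro p
    obtain ⟨r, ⟨hr, hpr⟩, -⟩ := hT.2 _ ((pointingRight_mem_holeyHexagon (p : ℤ × ℤ)).2 p.2)
    obtain ⟨p', q, hpq, rfl⟩ := hrhombus r hr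
    rw [right_mem_rhombusOf] at hpr
    exact ⟨q, by rwa [hpr], by rwa [hpr]⟩
  choose f hf hfT using hright
  have hunique : ∀ (p : rightEdges n m s) (q : leftEdges n m s),
      rhombusOf p q ∈ T → q = f p := by
    intro p q h
    have := (hT.2 _ ((pointingRight_mem_holeyHexagon (p : ℤ × ℤ)).2 p.2)).unique
      ⟨h, right_mem_rhombusOf.2 rfl⟩ ⟨hfT p, right_mem_rhombusOf.2 rfl⟩
    exact Subtype.ext (rhombusOf_injective this).2
  have hbij : Function.Bijective f := by
    constructor
    · intro p p' h
      have := (hT.2 _ ((pointingLeft_mem_holeyHexagon (f p : ℤ × ℤ)).2 (f p).2)).unique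
        ⟨hfT p, left_mem_rhombusOf.2 rfl⟩ ⟨hfT p', left_mem_rhombusOf.2 (by rw [h])⟩
      exact Subtype.ext (rhombusOf_injective this).1
    · intro q
      obtain ⟨r, ⟨hr, hqr⟩, -⟩ := hT.2 _ ((pointingLeft_mem_holeyHexagon (q : ℤ × ℤ)).2 q.2)
      obtain ⟨p, q', -, rfl⟩ := hrhombus r hr
      rw [left_mem_rhombusOf] at hqr
      exact ⟨p, (hunique p q (by rwa [hqr])).symm⟩
  refine ⟨Equiv.ofBijective f hbij, hf, ?_⟩
  ext r
  constructor
  · rintro ⟨p, rfl⟩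
    exact hfT p
  · intro hr
    obtain ⟨p, q, -, rfl⟩ := hrhombus r hr
    exact ⟨p, by simp only [Equiv.ofBijective_apply]; rw [hunique p q hr]⟩

theorem ncard_rhombusTilings_holeyHexagon (n m s : ℕ) :
    (rhombusTilings (holeyHexagon n m s)).ncard
      = (perfectMatchings (rightEdges n m s) (leftEdges n m s)).card := by
  have : rhombusTilings (holeyHexagon n m s)
      = tilingOf '' (perfectMatchings (rightEdges n m s) (leftEdges n m s) :
        Set (rightEdges n m s ≃ leftEdges n m s)) := by
    ext T
    simp only [rhombusTilings, Set.mem_ofPred_eq, Set.mem_image, Finset.mem_coe, perfectMatchings,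
      Finset.mem_filter, Finset.mem_univ, true_and]
    exact ⟨exists_tilingOf_eq, fun ⟨φ, hφ, h⟩ => h ▸ isRhombusTiling_tilingOf hφ⟩
  rw [this, Set.ncard_image_of_injective _ tilingOf_injective, Set.ncard_coe_finset]

end Tilings

theorem theorem1 (n m s : ℕ) (hm : 1 ≤ m) (hs : 1 ≤ s) (hsn : s < n) :
    ((rhombusTilings (holeyHexagon n m s)).ncard : ℚ) =
      ((2 * m - 1 : ℚ) * (Nat.choose (2 * m - 2) (m - 1) : ℚ)
          * (Nat.choose (2 * n - 2 * s) (n - s) : ℚ) * (Nat.choose (2 * s) s : ℚ))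
        / (Nat.choose (2 * m + 2 * n) (m + n) : ℚ)
        * boxProduct n n (2 * m) := by
  obtain ⟨φ₀, h⟩ := exists_card_perfectMatchings_eq_abs_det hm hs hsn
  -- These substitutions express `m - 1`, `s - 1` and `n - s - 1` as natural numbers, which removes
  -- truncated subtraction.
  obtain ⟨N, rfl⟩ : ∃ N, m = N + 1 := ⟨m - 1, by omega⟩
  obtain ⟨s, rfl⟩ : ∃ s', s = s' + 1 := ⟨s - 1, by omega⟩
  obtain ⟨t, rfl⟩ : ∃ t, n = s + t + 2 := ⟨n - s - 2, by omega⟩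
  rw [ncard_rhombusTilings_holeyHexagon, h, abs_det_adjacency]
  simp only [Nat.centralBinom]
  rw [show 2 * (N + 1) - 2 = 2 * N by omega, show N + 1 - 1 = N by omega,
    show s + t + 2 - (s + 1) = t + 1 by omega,
    show 2 * (s + t + 2) - 2 * (s + 1) = 2 * (t + 1) by omega,
    show 2 * (N + 1) + 2 * (s + t + 2) = 2 * (N + 1 + (s + t + 2)) by ring]
  push_cast
  ring
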